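/- **Setting.** Let $d\ge 1$, $\sigma\ge 0$. Let $(X,Y)$ be a random pair with $X$ uniformly distributed on $[0,1]^d$ and $Y=f^\star(X)+\varepsilon$, where $f^\star(X)=\mathbb E[Y\mid X]$ and the noise $\varepsilon$ is a centered Gaussian variable with variance $\sigma^2$. Let $(X_1,Y_1),(X_2,Y_2),\dots$ be i.i.d. copies of $(X,Y)$, independent of $X$. A *random centered tree* $\Theta$ of depth $k$ partitions $[0,1]^d$ as follows: starting from $[0,1]^d$, at each of $k$ successive levels every current cell is cut into two halves at its center along a coordinate drawn uniformly from $\{1,\dots,d\}$, the draws for different cells being independent of each other and of the data. Let $A(x,\Theta)$ be the final cell containing $x$ and $K_k(x,z)=\mathbb P_\Theta[z\in A(x,\Theta)]$. The *infinite centered kernel random forest (KeRF)* of depth $k$ is $$f^{\mathrm{KeRF}}_{\infty,n}(x)=\frac{\sum_{i=1}^n Y_iK_k(x,X_i)}{\sum_{i=1}^nK_k(x,X_i)},$$ with value $0$ if the denominator vanishes. The risk of an estimator $f_n$ built on the first $n$ pairs is $\mathcal R(f_n)=\mathbb E[(f_n(X)-f^\star(X))^2]$. **Theorem.** For all $d\ge1$,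 $\sigma\ge 0$, $L$, $B$ there is a constant $C>0$, depending only on $d,\sigma,L,B$, such that in the above setting, for every $f^\star$ that is $L$-Lipschitz on $[0,1]^d$ (for the Euclidean norm) with $\sup_{[0,1]^d}|f^\star|\le B$, the infinite centered KeRF of depth $k_n=\lfloor\log_2 n\rfloor$ has a finite risk satisfying, for all $n\ge2$, $$\mathcal R\big(f^{\mathrm{KeRF}}_{\infty,n}\big)\le C\,(\log n)^{-(d-11)/6}.$$ Hence, if $d>11$, it is consistent: $\lim_{n\to\infty}\mathcal R\big(f^{\mathrm{KeRF}}_{\infty,n}\big)=0$. -/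

import Mathlib

open MeasureTheory ProbabilityTheory Filter Topology
open scoped NNReal

/-- A centered tree of depth `k` in dimension `d`: a full binary tree of depth `k`, each internal
node of which carries the coordinate along which the corresponding cell is cut at its center. -/
inductive CenteredTree (d : ℕ) : ℕ → Type
  | leaf : CenteredTree d 0
  | node {k : ℕ} (j : Fin d) (left right : CenteredTree d k) : CenteredTree d (k + 1)

/-- The leaf, among those obtained by growing the given tree from the cell `S`, in which `x` falls.
The cell `S` is a box with lower corner `a` and upper corner `b`. The tree first cuts it along its
coordinate `j` at the center `(a j + b j) / 2`; points on the cut belong to the lower half. -/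
noncomputable def CenteredTree.cellIn {d : ℕ} : {k : ℕ} → CenteredTree d k →
    (S : Set (Fin d → ℝ)) → (a b : Fin d → ℝ) → (x : Fin d → ℝ) → Set (Fin d → ℝ)
  | _, .leaf, S, _, _, _ => S
  | _, .node j left right, S, a, b, x =>
      if x j ≤ (a j + b j) / 2 then
        left.cellIn (S ∩ {z | z j ≤ (a j + b j) / 2}) a (Function.update b j ((a j + b j) / 2)) x
      else
        right.cellIn (S ∩ {z | (a j + b j) / 2 < z j}) (Function.update a j ((a j + b j) / 2)) b x

/-- The cell `A(x, Θ)` containing `x` of the partition of `[0,1]^d` given by the tree `Θ`. -/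
noncomputable def CenteredTree.cell {d k : ℕ} (Θ : CenteredTree d k) (x : Fin d → ℝ) :
    Set (Fin d → ℝ) :=
  Θ.cellIn (Set.Icc 0 1) 0 1 x

/-- The law of a random centered tree `Θ` of depth `k`: the coordinates cut at the different nodes
are independent and uniformly distributed over the `d` coordinates. -/
noncomputable def centeredTreeLaw (d : ℕ) [NeZero d] : (k : ℕ) → PMF (CenteredTree d k)
  | 0 => PMF.pure .leaf
  | k + 1 =>
      (PMF.uniformOfFintype (Fin d)).bind fun j =>
        (centeredTreeLaw d k).bind fun left =>
          (centeredTreeLaw d k).bind fun right => PMF.pure (.node j left right)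

/-- The connection function of the infinite centered forest of depth `k`:
`K x z` is the probability, with respect to the random tree `Θ`, that `z ∈ A(x, Θ)`. -/
noncomputable def centeredKernel (d : ℕ) [NeZero d] (k : ℕ) (x z : Fin d → ℝ) : ℝ :=
  ((centeredTreeLaw d k).toOuterMeasure {Θ | z ∈ Θ.cell x}).toReal

/-- The infinite centered kernel random forest of depth `k` built on the sample
`(xs i, ys i)`, `i < n`, evaluated at `x` (it is `0` where all the weights vanish). -/
noncomputable def infiniteKeRF (d : ℕ) [NeZero d] (k n : ℕ) (xs : ℕ → Fin d → ℝ) (ys : ℕ → ℝ)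
    (x : Fin d → ℝ) : ℝ :=
  (∑ i ∈ Finset.range n, ys i * centeredKernel d k x (xs i)) /
    ∑ i ∈ Finset.range n, centeredKernel d k x (xs i)

/-- The regression model: `X` is uniform on `[0,1]^d`, `fstar` is the regression function of `Y`
on `X`, the noise `Y - fstar X` is a centered Gaussian variable with variance `σ ^ 2`, and the
training pairs `(Xs i, Ys i)` are i.i.d. copies of `(X, Y)`, independent of `X`. -/
structure GaussianRegressionModel {Ω : Type*} [MeasurableSpace Ω] (P : Measure Ω) {d : ℕ}
    (fstar : (Fin d → ℝ) → ℝ) (σ : ℝ≥0) (X : Ω → Fin d → ℝ) (Y : Ω → ℝ)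
    (Xs : ℕ → Ω → Fin d → ℝ) (Ys : ℕ → Ω → ℝ) : Prop where
  measurable_X : Measurable X
  measurable_Y : Measurable Y
  measurable_Xs : ∀ i, Measurable (Xs i)
  measurable_Ys : ∀ i, Measurable (Ys i)
  uniform_X : P.map X = volume.restrict (Set.Icc 0 1)
  regression : P[Y | MeasurableSpace.comap X inferInstance] =ᵐ[P] fun ω => fstar (X ω)
  gaussian_noise : P.map (fun ω => Y ω - fstar (X ω)) = gaussianReal 0 (σ ^ 2)
  identDistrib : ∀ i, IdentDistrib (fun ω => (Xs i ω, Ys i ω)) (fun ω => (X ω, Y ω)) P P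
  iIndep : iIndepFun (fun i ω => (Xs i ω, Ys i ω)) P
  indep : IndepFun X (fun ω i => (Xs i ω, Ys i ω)) P

/-- The error `f_n(X) - fstar(X)` at the new point `X` of the infinite centered kernel random
forest `f_n` of depth `⌊log₂ n⌋`, built on the first `n` training pairs. -/
noncomputable def kerfError {Ω : Type*} {d : ℕ} [NeZero d] (fstar : (Fin d → ℝ) → ℝ)
    (X : Ω → Fin d → ℝ) (Xs : ℕ → Ω → Fin d → ℝ) (Ys : ℕ → Ω → ℝ) (n : ℕ) (ω : Ω) : ℝ :=
  infiniteKeRF d ⌊Real.logb 2 n⌋₊ n (fun i => Xs i ω) (fun i => Ys i ω) (X ω) - fstar (X ω)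

/-- The quadratic risk `E[(f_n(X) - fstar(X))^2]` of that estimator. -/
noncomputable def kerfRisk {Ω : Type*} [MeasurableSpace Ω] (P : Measure Ω) {d : ℕ} [NeZero d]
    (fstar : (Fin d → ℝ) → ℝ) (X : Ω → Fin d → ℝ) (Xs : ℕ → Ω → Fin d → ℝ) (Ys : ℕ → Ω → ℝ)
    (n : ℕ) : ℝ :=
  ∫ ω, kerfError fstar X Xs Ys n ω ^ 2 ∂P

/-! The kernel is explicit. Whether `z` lies in the cell of `x` depends only on the cuts met along
the path of `x`, hence only on the vector `m` of the numbers of cuts per coordinate, which is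
multinomial. So `centeredKernel` is the mean over `m` of the indicator of a dyadic box of side
lengths `2^(-m j)` (`centeredKernel_eq`). Such a box has volume `2^(-k)`, and three integrals over
the cube follow: `∫ K = 2^(-k)`; `∫ K (z j - x j)^2 ≤ 2^(-k) (1 - 3/(4d))^k`, since each draw
multiplies `4^(-m j)` by `1 - 3/(4d)` on average; and `∫ K^2 = E 2^(-∑ max (m j) (m' j))` for two
independent multinomial vectors. The last is `2^(-k) E ∏ s^|m j - m' j|` with `s^2 = 1/2`. Bounding
every multinomial probability by its order at the mode, `k^(-(d-1)/2)`, leaves products of geometric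
sums, whence `∫ K^2 = O(2^(-k) k^(-(d-1)/2))` (`exists_integral_centeredKernel_sq_le`).

With `k = ⌊log₂ n⌋` the total weight `S` has mean `M = n 2^(-k)` in `[1, 2]` and variance
`O(k^(-(d-1)/2))`, so it concentrates although a cell holds only boundedly many points on average.
The bound `sq_weighted_error_le` separates two cases. If `S ≥ 1/2`, the denominator is harmless:
Jensen's inequality controls the bias, and the noise is a sum of conditionally centered terms with
second moment of order `n ∫ K^2`. If `S < 1/2`, then `4 (S - M)^2 ≥ 1`, and the error, at most of
the order of `B^2 + max_i ε_i^2`, may be multiplied by this factor. The maximum is at most a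
multiple of `log n` plus a remainder of mean `O(1/n)` (`sq_le_log_add_sum_exp`). As this holds
pointwise, no independence between noise and weights is needed.

The risk is thus at most of order `r^k + (1 + log n) k^(-(d-1)/2) + 1/n` with `r < 1`, that is `(log
n)^(-(d-3)/2)`, which is stronger than the stated rate. -/

/-- The set of the reals that stay on the same side as `x` during `n` successive halvings of the
interval with end points `a` and `b`, each step keeping the half in which `x` falls. -/
noncomputable def dyadicCell : ℕ → ℝ → ℝ → ℝ → Set ℝ
  | 0, _, _, _ => Set.univ
  | n + 1, a, b, x =>
      if x ≤ (a + b) / 2 then Set.Iic ((a + b) / 2) ∩ dyadicCell n a ((a + b) / 2) x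
      else Set.Ioi ((a + b) / 2) ∩ dyadicCell n ((a + b) / 2) b x

/-- The expectation of `F m`, where `m` counts how often each of the `d` coordinates is drawn in
`k` independent uniform draws. -/
noncomputable def splitMean (d : ℕ) : ℕ → ((Fin d → ℕ) → ℝ) → ℝ
  | 0, F => F 0
  | k + 1, F => (∑ j, splitMean d k fun m => F (m + Pi.single j 1)) / d

/-- The dyadic box of depth `m` around `x` in the box with corners `a` and `b`. -/
def dyadicBox {d : ℕ} (m : Fin d → ℕ) (a b x : Fin d → ℝ) : Set (Fin d → ℝ) :=
  {z | ∀ j, z j ∈ dyadicCell (m j) (a j) (b j) (x j)}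

/-! ### Averages over the numbers of cuts per coordinate. -/

section splitMean

variable {d : ℕ}

lemma splitMean_mono {k : ℕ} {F G : (Fin d → ℕ) → ℝ} (h : ∀ m, ∑ j, m j = k → F m ≤ G m) :
    splitMean d k F ≤ splitMean d k G := by
  induction k generalizing F G with
  | zero => exact h 0 (by simp)
  | succ k ih =>
    simp only [splitMean]
    gcongr with j
    refine ih fun m hm => h _ ?_
    simp [Finset.sum_add_distrib, hm]

lemma splitMean_congr {k : ℕ} {F G : (Fin d → ℕ) → ℝ} (h : ∀ m, ∑ j, m j = k → F m = G m) :
    splitMean d k F = splitMean d k G :=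
  le_antisymm (splitMean_mono fun m hm => (h m hm).le) (splitMean_mono fun m hm => (h m hm).ge)

lemma splitMean_const_mul (k : ℕ) (c : ℝ) (F : (Fin d → ℕ) → ℝ) :
    splitMean d k (fun m => c * F m) = c * splitMean d k F := by
  induction k generalizing F with
  | zero => rfl
  | succ k ih =>
    simp only [splitMean, ih]
    rw [← Finset.mul_sum, mul_div_assoc]

lemma splitMean_const [NeZero d] (k : ℕ) (c : ℝ) : splitMean d k (fun _ => c) = c := by
  induction k with
  | zero => rfl
  | succ k ih =>
    simp only [splitMean, ih]
    simp [NeZero.ne d]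

lemma measurable_splitMean {α : Type*} [MeasurableSpace α] (k : ℕ) {F : (Fin d → ℕ) → α → ℝ}
    (h : ∀ m, Measurable (F m)) : Measurable fun z => splitMean d k fun m => F m z := by
  induction k generalizing F with
  | zero => exact h 0
  | succ k ih =>
    simp only [splitMean]
    exact (Finset.measurable_sum _ fun j _ => ih fun m => h _).div_const _

lemma integrable_splitMean {α : Type*} [MeasurableSpace α] {μ : Measure α} (k : ℕ)
    {F : (Fin d → ℕ) → α → ℝ} (h : ∀ m, Integrable (F m) μ) :
    Integrable (fun z => splitMean d k fun m => F m z) μ := by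
  induction k generalizing F with
  | zero => exact h 0
  | succ k ih =>
    simp only [splitMean]
    exact (integrable_finsetSum _ fun j _ => ih fun m => h _).div_const _

lemma integral_splitMean {α : Type*} [MeasurableSpace α] {μ : Measure α} (k : ℕ)
    {F : (Fin d → ℕ) → α → ℝ} (h : ∀ m, Integrable (F m) μ) :
    ∫ z, (splitMean d k fun m => F m z) ∂μ = splitMean d k fun m => ∫ z, F m z ∂μ := by
  induction k generalizing F with
  | zero => rfl
  | succ k ih =>
    simp only [splitMean]
    rw [integral_div, integral_finsetSum _ fun j _ => integrable_splitMean k fun m => h _]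
    congr 1
    exact Finset.sum_congr rfl fun j _ => ih fun m => h _

/-- Each draw hits coordinate `i` with probability `1 / d` and then contributes a factor `c`, so its
mean factor is `1 - (1 - c) / d`; the draws are independent. -/
lemma splitMean_pow [NeZero d] (k : ℕ) (i : Fin d) (c : ℝ) :
    splitMean d k (fun m => c ^ m i) = (1 - (1 - c) / d) ^ k := by
  induction k with
  | zero => simp [splitMean]
  | succ k ih =>
    have hd : (d : ℝ) ≠ 0 := by exact_mod_cast NeZero.ne d
    have h1 : ∀ j : Fin d, (splitMean d k fun m => c ^ (m + Pi.single j 1 : Fin d → ℕ) i) =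
        (if j = i then c else 1) * (1 - (1 - c) / d) ^ k := by
      intro j
      rw [← ih, ← splitMean_const_mul]
      congr 1
      funext m
      by_cases h : j = i
      · subst h; simp [pow_succ, mul_comm]
      · simp [h, Ne.symm h]
    simp only [splitMean, h1]
    rw [← Finset.sum_mul]
    have h2 : (∑ j : Fin d, if j = i then c else (1 : ℝ)) = c + (d - 1) := by
      have : ∀ j : Fin d, (if j = i then c else (1 : ℝ)) = 1 + (if j = i then c - 1 else 0) := by
        intro j; split_ifs <;> ring
      simp only [this, Finset.sum_add_distrib]
      simp
      ring
    rw [h2, pow_succ]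
    field_simp
    ring

end splitMean

/-! ### Dyadic intervals: nesting, measurability, length. -/

section dyadicCell

/-- Both memberships say that the two points take the same side at each of the `n` halvings. -/
lemma mem_dyadicCell_comm {n : ℕ} {a b x z : ℝ} :
    z ∈ dyadicCell n a b x ↔ x ∈ dyadicCell n a b z := by
  induction n generalizing a b with
  | zero => simp [dyadicCell]
  | succ n ih =>
    simp only [dyadicCell]
    by_cases hx : x ≤ (a + b) / 2 <;> by_cases hz : z ≤ (a + b) / 2
    · simp [hx, hz, ih]
    · simp [hx, hz, not_lt.2 hx]
    · simp [hx, hz, not_lt.2 hz]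
    · simp [hx, hz, ih, not_le.1 hx, not_le.1 hz]

lemma dyadicCell_antitone (a b x : ℝ) : Antitone fun n => dyadicCell n a b x := by
  refine antitone_nat_of_succ_le fun n => ?_
  induction n generalizing a b with
  | zero => simp [dyadicCell]
  | succ n ih =>
    rw [dyadicCell.eq_def (n + 1 + 1), dyadicCell.eq_def (n + 1)]
    dsimp only
    split_ifs
    · exact Set.inter_subset_inter_right _ (ih _ _)
    · exact Set.inter_subset_inter_right _ (ih _ _)

lemma measurableSet_dyadicCell_prod {α : Type*} [MeasurableSpace α] {f g : α → ℝ}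
    (hf : Measurable f) (hg : Measurable g) (n : ℕ) (a b : ℝ) :
    MeasurableSet {p | g p ∈ dyadicCell n a b (f p)} := by
  induction n generalizing a b with
  | zero => simp [dyadicCell]
  | succ n ih =>
    have : {p | g p ∈ dyadicCell (n + 1) a b (f p)} =
        ({p | f p ≤ (a + b) / 2} ∩ ({p | g p ≤ (a + b) / 2} ∩
          {p | g p ∈ dyadicCell n a ((a + b) / 2) (f p)})) ∪
        ({p | (a + b) / 2 < f p} ∩ ({p | (a + b) / 2 < g p} ∩
          {p | g p ∈ dyadicCell n ((a + b) / 2) b (f p)})) := by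
      ext p
      by_cases h : f p ≤ (a + b) / 2
      · simp [dyadicCell, h, not_lt.2 h]
      · simp [dyadicCell, h, not_le.1 h]
    rw [this]
    exact ((measurableSet_le hf measurable_const).inter
      ((measurableSet_le hg measurable_const).inter (ih _ _))).union
      ((measurableSet_lt measurable_const hf).inter
      ((measurableSet_lt measurable_const hg).inter (ih _ _)))

lemma measurableSet_dyadicCell (n : ℕ) (a b x : ℝ) : MeasurableSet (dyadicCell n a b x) :=
  measurableSet_dyadicCell_prod (f := fun _ : ℝ => x) measurable_const measurable_id n a b

lemma volume_Icc_inter_dyadicCell {n : ℕ} {a b x : ℝ} (hab : a ≤ b) :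
    volume (Set.Icc a b ∩ dyadicCell n a b x) = ENNReal.ofReal ((b - a) * (1 / 2) ^ n) := by
  induction n generalizing a b with
  | zero => simp [dyadicCell]
  | succ n ih =>
    have h1 : a ≤ (a + b) / 2 := by linarith
    have h2 : (a + b) / 2 ≤ b := by linarith
    rw [dyadicCell]
    split_ifs with h
    · rw [← Set.inter_assoc, show Set.Icc a b ∩ Set.Iic ((a + b) / 2) = Set.Icc a ((a + b) / 2) by
        ext z; simp only [Set.mem_inter_iff, Set.mem_Icc, Set.mem_Iic]
        exact ⟨fun hh => ⟨hh.1.1, hh.2⟩, fun hh => ⟨⟨hh.1, hh.2.trans h2⟩, hh.2⟩⟩, ih h1]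
      congr 1; rw [pow_succ]; ring
    -- The upper half is open at its left end, while the induction hypothesis speaks of a closed
    -- interval; the end point is a null set.
    · rw [← Set.inter_assoc, show Set.Icc a b ∩ Set.Ioi ((a + b) / 2) = Set.Ioc ((a + b) / 2) b by
        ext z; simp; constructor
        · rintro ⟨⟨_, h⟩, h'⟩; exact ⟨h', h⟩
        · rintro ⟨h, h'⟩; exact ⟨⟨by linarith, h'⟩, h⟩,
        measure_congr ((Ioc_ae_eq_Icc (μ := volume)).inter
          (ae_eq_refl (dyadicCell n ((a + b) / 2) b x))), ih h2]
      congr 1; rw [pow_succ]; ring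

lemma abs_sub_le_of_mem_dyadicCell {n : ℕ} {a b x z : ℝ} (hx : x ∈ Set.Icc a b)
    (hz : z ∈ Set.Icc a b) (h : z ∈ dyadicCell n a b x) : |z - x| ≤ (b - a) * (1 / 2) ^ n := by
  induction n generalizing a b with
  | zero =>
    obtain ⟨h1, h2⟩ := hx
    obtain ⟨h3, h4⟩ := hz
    rw [abs_le]; constructor <;> simp <;> linarith
  | succ n ih =>
    rw [dyadicCell] at h
    split_ifs at h with hh
    · refine (ih ⟨hx.1, hh⟩ ⟨hz.1, h.1⟩ h.2).trans_eq ?_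
      rw [pow_succ]; ring
    · refine (ih ⟨(not_le.1 hh).le, hx.2⟩ ⟨(Set.mem_Ioi.1 h.1).le, hz.2⟩ h.2).trans_eq ?_
      rw [pow_succ]; ring

end dyadicCell

/-! ### The kernel as a mean of indicators of dyadic boxes, and its integrals. -/

section kernel

variable {d : ℕ}

/-- A cut along `j` changes the box in coordinate `j` only, so it can be taken as the first halving
of that coordinate whatever the other cuts are. This is why only the counts matter, not the order of
the cuts. -/
lemma mem_dyadicBox_add_single_of_le {m : Fin d → ℕ} {j : Fin d} {a b x z : Fin d → ℝ}
    (h : x j ≤ (a j + b j) / 2) : z ∈ dyadicBox (m + Pi.single j 1) a b x ↔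
      z j ≤ (a j + b j) / 2 ∧
        z ∈ dyadicBox m a (Function.update b j ((a j + b j) / 2)) x := by
  simp only [dyadicBox, Set.mem_ofPred_eq]
  constructor
  · intro H
    have hj := H j
    simp [dyadicCell, h] at hj
    refine ⟨hj.1, fun i => ?_⟩
    by_cases hi : i = j
    · subst hi; simpa using hj.2
    · simpa [hi, Pi.single_apply] using H i
  · rintro ⟨h1, H⟩ i
    have Hi := H i
    by_cases hi : i = j
    · subst hi; simp [dyadicCell, h, h1] at Hi ⊢; exact Hi
    · simpa [hi, Pi.single_apply] using Hi

lemma mem_dyadicBox_add_single_of_lt {m : Fin d → ℕ} {j : Fin d} {a b x z : Fin d → ℝ}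
    (h : ¬ x j ≤ (a j + b j) / 2) : z ∈ dyadicBox (m + Pi.single j 1) a b x ↔
      (a j + b j) / 2 < z j ∧
        z ∈ dyadicBox m (Function.update a j ((a j + b j) / 2)) b x := by
  simp only [dyadicBox, Set.mem_ofPred_eq]
  constructor
  · intro H
    have hj := H j
    simp [dyadicCell, h] at hj
    refine ⟨hj.1, fun i => ?_⟩
    by_cases hi : i = j
    · subst hi; simpa using hj.2
    · simpa [hi, Pi.single_apply] using H i
  · rintro ⟨h1, H⟩ i
    have Hi := H i
    by_cases hi : i = j
    · subst hi; simp [dyadicCell, h, h1] at Hi ⊢; exact Hi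
    · simpa [hi, Pi.single_apply] using Hi

/-- The dyadic box of depth `m` around `x` in the unit cube. -/
def unitBox (m : Fin d → ℕ) (x : Fin d → ℝ) : Set (Fin d → ℝ) :=
  Set.Icc 0 1 ∩ dyadicBox m 0 1 x

lemma unitBox_eq_pi (m : Fin d → ℕ) (x : Fin d → ℝ) :
    unitBox m x = Set.univ.pi fun j => Set.Icc 0 1 ∩ dyadicCell (m j) 0 1 (x j) := by
  ext z
  simp [unitBox, dyadicBox, Set.mem_pi, Pi.le_def, forall_and]

lemma measurableSet_unitBox (m : Fin d → ℕ) (x : Fin d → ℝ) : MeasurableSet (unitBox m x) := by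
  rw [unitBox_eq_pi]
  exact MeasurableSet.univ_pi fun j => measurableSet_Icc.inter (measurableSet_dyadicCell _ _ _ _)

/-- In each coordinate the two dyadic intervals around `x j` are nested, and the deeper one remains.
-/
lemma unitBox_inter (m m' : Fin d → ℕ) (x : Fin d → ℝ) :
    unitBox m x ∩ unitBox m' x = unitBox (m ⊔ m') x := by
  simp only [unitBox_eq_pi, ← Set.pi_inter_distrib]
  congr 1; funext j
  rcases le_total (m j) (m' j) with h | h
  · rw [Pi.sup_apply, sup_of_le_right h]
    exact Set.inter_eq_right.2 (Set.inter_subset_inter_right _ (dyadicCell_antitone _ _ _ h))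
  · rw [Pi.sup_apply, sup_of_le_left h]
    exact Set.inter_eq_left.2 (Set.inter_subset_inter_right _ (dyadicCell_antitone _ _ _ h))

lemma volume_unitBox (m : Fin d → ℕ) (x : Fin d → ℝ) :
    volume.real (unitBox m x) = (1 / 2) ^ ∑ j, m j := by
  rw [measureReal_def, unitBox_eq_pi, volume_pi_pi]
  simp only [volume_Icc_inter_dyadicCell zero_le_one, ENNReal.toReal_prod]
  rw [← Finset.prod_pow_eq_pow_sum]
  exact Finset.prod_congr rfl fun j _ => by rw [ENNReal.toReal_ofReal (by positivity)]; simp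

instance : IsProbabilityMeasure (volume.restrict (Set.Icc (0 : Fin d → ℝ) 1)) :=
  ⟨by simp [Real.volume_Icc_pi]⟩

lemma integral_indicator_unitBox (m : Fin d → ℕ) (x : Fin d → ℝ) :
    ∫ z in Set.Icc (0 : Fin d → ℝ) 1, (unitBox m x).indicator 1 z = (1 / 2 : ℝ) ^ ∑ j, m j := by
  rw [integral_indicator_one (measurableSet_unitBox m x),
    measureReal_restrict_apply (measurableSet_unitBox m x), ← volume_unitBox m x,
    Set.inter_eq_left.2 (show unitBox m x ⊆ _ from Set.inter_subset_left)]

lemma integrable_indicator_unitBox (m : Fin d → ℕ) (x : Fin d → ℝ) :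
    Integrable ((unitBox m x).indicator (1 : (Fin d → ℝ) → ℝ))
      (volume.restrict (Set.Icc (0 : Fin d → ℝ) 1)) :=
  (integrable_const (1 : ℝ)).indicator (measurableSet_unitBox m x)

variable [NeZero d]

/-- Given the coordinate of the root, only the subtree on the side of `x` matters; the law of the
other one sums to `1`. -/
lemma toOuterMeasure_cellIn_succ (k : ℕ) (S : Set (Fin d → ℝ)) (a b x z : Fin d → ℝ) :
    (centeredTreeLaw d (k + 1)).toOuterMeasure {Θ | z ∈ Θ.cellIn S a b x} =
      ∑ j, (d : ENNReal)⁻¹ * (centeredTreeLaw d k).toOuterMeasure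
        (if x j ≤ (a j + b j) / 2 then
          {Θ | z ∈ Θ.cellIn (S ∩ {z | z j ≤ (a j + b j) / 2}) a
            (Function.update b j ((a j + b j) / 2)) x}
        else {Θ | z ∈ Θ.cellIn (S ∩ {z | (a j + b j) / 2 < z j})
            (Function.update a j ((a j + b j) / 2)) b x}) := by
  classical
  simp only [centeredTreeLaw, PMF.toOuterMeasure_bind_apply, tsum_fintype,
    PMF.uniformOfFintype_apply, Fintype.card_fin, PMF.toOuterMeasure_pure_apply,
    Set.mem_ofPred_eq, CenteredTree.cellIn]
  refine Finset.sum_congr rfl fun j _ => ?_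
  congr 1
  split_ifs with h
  · simp only [ENNReal.tsum_mul_right, PMF.tsum_coe, one_mul]
    rw [PMF.toOuterMeasure_apply]
    exact tsum_congr fun l => by simp [Set.indicator_apply]
  · simp only [ENNReal.tsum_mul_right, PMF.tsum_coe, one_mul]
    rw [PMF.toOuterMeasure_apply]
    exact tsum_congr fun l => by simp [Set.indicator_apply]

/-- The induction must let the starting cell vary. `S` carries the constraints already imposed,
while `dyadicBox` records only future cuts and is the whole space at depth `0`. -/
lemma toOuterMeasure_cellIn_toReal (k : ℕ) (S : Set (Fin d → ℝ)) (a b x z : Fin d → ℝ) :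
    ((centeredTreeLaw d k).toOuterMeasure {Θ | z ∈ Θ.cellIn S a b x}).toReal =
      splitMean d k fun m => (S ∩ dyadicBox m a b x).indicator 1 z := by
  classical
  induction k generalizing S a b with
  | zero =>
    rw [centeredTreeLaw, PMF.toOuterMeasure_pure_apply, splitMean]
    by_cases h : z ∈ S
    · have h' : CenteredTree.leaf ∈ {Θ : CenteredTree d 0 | z ∈ Θ.cellIn S a b x} := h
      rw [if_pos h', Set.indicator_of_mem (show z ∈ S ∩ dyadicBox 0 a b x from
        ⟨h, fun j => Set.mem_univ _⟩)]
      simp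
    · have h' : CenteredTree.leaf ∉ {Θ : CenteredTree d 0 | z ∈ Θ.cellIn S a b x} := h
      rw [if_neg h', Set.indicator_of_notMem fun hh => h hh.1]
      simp
  | succ k ih =>
    rw [toOuterMeasure_cellIn_succ, ENNReal.toReal_sum, splitMean, Finset.sum_div]
    · refine Finset.sum_congr rfl fun j _ => ?_
      rw [ENNReal.toReal_mul, ENNReal.toReal_inv, ENNReal.toReal_natCast, mul_comm (d : ℝ)⁻¹,
        ← div_eq_mul_inv]
      refine congrArg (· / (d : ℝ)) ?_
      split_ifs with h
      · rw [ih]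
        congr 1; funext m
        simp only [Set.indicator_apply, Set.mem_inter_iff, mem_dyadicBox_add_single_of_le h,
          Set.mem_ofPred_eq, and_assoc]
      · rw [ih]
        congr 1; funext m
        simp only [Set.indicator_apply, Set.mem_inter_iff, mem_dyadicBox_add_single_of_lt h,
          Set.mem_ofPred_eq, and_assoc]
    · intro j _
      refine ENNReal.mul_ne_top (by simp [NeZero.ne d]) ?_
      refine ne_top_of_le_ne_top ENNReal.one_ne_top ?_
      rw [PMF.toOuterMeasure_apply, ← PMF.tsum_coe (centeredTreeLaw d k)]
      exact ENNReal.tsum_le_tsum fun l => Set.indicator_le_self _ _ _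

lemma centeredKernel_eq (k : ℕ) (x z : Fin d → ℝ) :
    centeredKernel d k x z = splitMean d k fun m => (unitBox m x).indicator 1 z :=
  toOuterMeasure_cellIn_toReal k _ _ _ x z

lemma centeredKernel_nonneg (k : ℕ) (x z : Fin d → ℝ) : 0 ≤ centeredKernel d k x z :=
  ENNReal.toReal_nonneg

lemma centeredKernel_le_one (k : ℕ) (x z : Fin d → ℝ) : centeredKernel d k x z ≤ 1 := by
  rw [centeredKernel_eq, ← splitMean_const (d := d) k 1]
  refine splitMean_mono fun m _ => ?_
  exact Set.indicator_le_self' (fun _ _ => zero_le_one) _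

lemma measurable_centeredKernel (k : ℕ) :
    Measurable fun p : (Fin d → ℝ) × (Fin d → ℝ) => centeredKernel d k p.1 p.2 := by
  simp only [centeredKernel_eq]
  refine measurable_splitMean k fun m => ?_
  have h : MeasurableSet {p : (Fin d → ℝ) × (Fin d → ℝ) | p.2 ∈ unitBox m p.1} := by
    have : {p : (Fin d → ℝ) × (Fin d → ℝ) | p.2 ∈ unitBox m p.1} =
        Prod.snd ⁻¹' Set.Icc 0 1 ∩ ⋂ j : Fin d, {p : (Fin d → ℝ) × (Fin d → ℝ) | p.2 j ∈ dyadicCell (m j) 0 1 (p.1 j)} := by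
      ext p; simp [unitBox, dyadicBox]
    rw [this]
    refine (measurable_snd measurableSet_Icc).inter (MeasurableSet.iInter fun j => ?_)
    exact measurableSet_dyadicCell_prod (by fun_prop) (by fun_prop) _ _ _
  exact (measurable_const (a := (1 : ℝ))).indicator h

lemma centeredKernel_comm (k : ℕ) {x z : Fin d → ℝ} (hx : x ∈ Set.Icc 0 1)
    (hz : z ∈ Set.Icc 0 1) : centeredKernel d k x z = centeredKernel d k z x := by
  classical
  simp only [centeredKernel_eq]
  congr 1; funext m
  simp only [Set.indicator_apply, unitBox, dyadicBox, Set.mem_inter_iff, hx, hz, true_and,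
    Set.mem_ofPred_eq]
  congr 1
  exact propext (forall_congr' fun j => mem_dyadicCell_comm)

lemma integral_centeredKernel (k : ℕ) (x : Fin d → ℝ) :
    ∫ z in Set.Icc (0 : Fin d → ℝ) 1, centeredKernel d k x z = (1 / 2) ^ k := by
  simp only [centeredKernel_eq]
  rw [integral_splitMean k fun m => integrable_indicator_unitBox m x,
    ← splitMean_const (d := d) k ((1 / 2) ^ k)]
  refine splitMean_congr fun m hm => ?_
  rw [integral_indicator_unitBox, hm]

/-- The square is a mean over two independent count vectors of products of indicators; two boxes
around the same `x` meet in the box of coordinatewise maximal depth. -/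
lemma integral_centeredKernel_sq (k : ℕ) (x : Fin d → ℝ) :
    ∫ z in Set.Icc (0 : Fin d → ℝ) 1, centeredKernel d k x z ^ 2 =
      splitMean d k fun m => splitMean d k fun m' => (1 / 2) ^ ∑ j, max (m j) (m' j) := by
  have h1 : ∀ z, centeredKernel d k x z ^ 2 = splitMean d k fun m => splitMean d k fun m' =>
      (unitBox (m ⊔ m') x).indicator 1 z := by
    intro z
    simp only [← unitBox_inter, Set.inter_indicator_one, Pi.mul_apply, splitMean_const_mul]
    rw [sq, ← centeredKernel_eq]
    simp only [mul_comm _ (centeredKernel d k x z), splitMean_const_mul]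
    rw [← centeredKernel_eq]
  simp only [h1]
  rw [integral_splitMean k fun m => integrable_splitMean k fun m' =>
    integrable_indicator_unitBox _ x]
  congr 1; funext m
  rw [integral_splitMean k fun m' => integrable_indicator_unitBox _ x]
  congr 1; funext m'
  rw [integral_indicator_unitBox]
  rfl

lemma centeredKernel_mul_sq_le (k : ℕ) {x : Fin d → ℝ} (hx : x ∈ Set.Icc 0 1) (j : Fin d)
    (z : Fin d → ℝ) : centeredKernel d k x z * (z j - x j) ^ 2 ≤
      splitMean d k fun m => (1 / 4) ^ m j * (unitBox m x).indicator 1 z := by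
  classical
  rw [centeredKernel_eq, mul_comm, ← splitMean_const_mul]
  refine splitMean_mono fun m _ => ?_
  by_cases h : z ∈ unitBox m x
  · simp only [Set.indicator_of_mem h]
    simp only [Pi.one_apply, mul_one]
    have h1 := abs_sub_le_of_mem_dyadicCell (n := m j) (a := 0) (b := 1) ⟨hx.1 j, hx.2 j⟩
      ⟨h.1.1 j, h.1.2 j⟩ (h.2 j)
    rw [← sq_abs]
    calc |z j - x j| ^ 2 ≤ ((1 - 0) * (1 / 2) ^ m j) ^ 2 := by gcongr
      _ = _ := by rw [sub_zero, one_mul, ← pow_mul, mul_comm, pow_mul]; norm_num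
  · simp [Set.indicator_of_notMem h]

/-- On a box of depth `m` the squared displacement along `j` is at most `4^(-m j)`, and every box
has volume `2^(-k)`; what remains is the mean of `(1 / 4)^(m j)`. -/
lemma integral_centeredKernel_mul_sq_le (k : ℕ) {x : Fin d → ℝ} (hx : x ∈ Set.Icc 0 1)
    (j : Fin d) : ∫ z in Set.Icc (0 : Fin d → ℝ) 1, centeredKernel d k x z * (z j - x j) ^ 2 ≤
      (1 / 2) ^ k * (1 - 3 / (4 * d)) ^ k := by
  have hi : ∀ m : Fin d → ℕ, Integrable
      (fun z => (1 / 4) ^ m j * (unitBox m x).indicator (1 : (Fin d → ℝ) → ℝ) z)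
      (volume.restrict (Set.Icc (0 : Fin d → ℝ) 1)) := fun m =>
    (integrable_indicator_unitBox m x).const_mul _
  calc _ ≤ ∫ z in Set.Icc (0 : Fin d → ℝ) 1,
        splitMean d k fun m => (1 / 4) ^ m j * (unitBox m x).indicator 1 z := by
        refine integral_mono_of_nonneg (ae_of_all _ fun z => ?_) (integrable_splitMean k hi)
          (ae_of_all _ fun z => centeredKernel_mul_sq_le k hx j z)
        exact mul_nonneg (centeredKernel_nonneg k x z) (sq_nonneg _)
    _ = _ := by
        rw [integral_splitMean k hi]
        simp only [integral_const_mul, integral_indicator_unitBox]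
        rw [splitMean_congr (G := fun m => (1 / 2) ^ k * (1 / 4) ^ m j)
          fun m hm => by rw [hm, mul_comm], splitMean_const_mul, splitMean_pow]
        congr 2
        rw [show (1 - 1 / 4 : ℝ) = 3 / 4 by norm_num, div_div]

end kernel

/-! ### Multinomial probabilities and the bound on the squared kernel. -/

section multinomial

variable {d : ℕ}

/-- Induction on the first draw: moving from `m` to `m + Pi.single j 1` turns the multinomial weight
into one with an extra factor `m j`, and these factors sum to `k + 1` over `j`. -/
lemma splitMean_eq_sum [NeZero d] (k : ℕ) (F : (Fin d → ℕ) → ℝ) :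
    splitMean d k F = ∑ m ∈ Finset.piAntidiag Finset.univ k,
      (k.factorial / (d ^ k * ∏ j, ((m j).factorial : ℝ)) : ℝ) * F m := by
  classical
  induction k generalizing F with
  | zero => simp [splitMean]
  | succ k ih =>
    have hd : (d : ℝ) ≠ 0 := by exact_mod_cast NeZero.ne d
    have hf : ∀ m : Fin d → ℕ, (∏ j, ((m j).factorial : ℝ)) ≠ 0 := fun m =>
      Finset.prod_ne_zero_iff.2 fun j _ => by positivity
    have key : ∀ j : Fin d, splitMean d k (fun m => F (m + Pi.single j 1)) =
        ∑ m ∈ Finset.piAntidiag Finset.univ (k + 1),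
          (k.factorial / (d ^ k * ∏ i, ((m i).factorial : ℝ)) : ℝ) * (m j * F m) := by
      intro j
      rw [ih]
      -- The shift misses the vectors with `m j = 0`, whose terms on the right vanish because of the
      -- factor `m j`.
      refine Finset.sum_bij_ne_zero (fun m _ _ => m + Pi.single j 1) ?_ ?_ ?_ ?_
      · intro m hm _
        simp only [Finset.mem_piAntidiag] at hm ⊢
        simp [Finset.sum_add_distrib, hm.1]
      · intro m _ _ m' _ _ h
        exact add_right_cancel h
      · intro m hm hne
        have hmj : m j ≠ 0 := by rintro h; simp [h] at hne
        have hs : m - Pi.single j 1 + Pi.single j 1 = m := by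
          funext i
          by_cases hi : i = j
          · subst hi; simp; omega
          · simp [hi]
        refine ⟨m - Pi.single j 1, ?_, ?_, hs⟩
        · simp only [Finset.mem_piAntidiag] at hm ⊢
          have h1 := hm.1
          rw [← hs] at h1
          simp only [Pi.add_apply, Finset.sum_add_distrib] at h1
          simp at h1 ⊢
          exact h1
        · have hF : F m ≠ 0 := fun h => by simp [h] at hne
          rw [hs]
          exact mul_ne_zero (div_ne_zero (by positivity)
            (mul_ne_zero (pow_ne_zero _ hd) (hf _))) hF
      · intro m hm _
        have h1 : (∏ i, (((m + Pi.single j 1 : Fin d → ℕ) i).factorial : ℝ)) =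
            (m j + 1) * ∏ i, ((m i).factorial : ℝ) := by
          rw [← Finset.mul_prod_erase _ _ (Finset.mem_univ j),
            ← Finset.mul_prod_erase (Finset.univ) (fun i => ((m i).factorial : ℝ))
              (Finset.mem_univ j), ← mul_assoc]
          congr 1
          · simp [Nat.factorial_succ]
          · refine Finset.prod_congr rfl fun i hi => ?_
            simp [Finset.ne_of_mem_erase hi]
        rw [h1]
        have := hf m
        have h2 : (m j + 1 : ℝ) ≠ 0 := by positivity
        simp only [Pi.add_apply, Pi.single_eq_same, Nat.cast_add, Nat.cast_one]
        field_simp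
    simp only [splitMean, key]
    rw [Finset.sum_comm, Finset.sum_div]
    refine Finset.sum_congr rfl fun m hm => ?_
    rw [← Finset.mul_sum, ← Finset.sum_mul, ← Nat.cast_sum, (Finset.mem_piAntidiag.1 hm).1]
    have := hf m
    rw [Nat.factorial_succ, pow_succ]
    push_cast
    field_simp

lemma factorial_add_le_factorial_mul_pow (m n : ℕ) :
    (m + n).factorial ≤ m.factorial * (m + n) ^ n := by
  induction n with
  | zero => simp
  | succ n ih =>
    calc (m + n + 1).factorial = (m + n + 1) * (m + n).factorial := Nat.factorial_succ _
      _ ≤ (m + n + 1) * (m.factorial * (m + n + 1) ^ n) := by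
        gcongr
        exact ih.trans (Nat.mul_le_mul_left _ (Nat.pow_le_pow_left (by omega) n))
      _ = _ := by ring

/-- The quantity `m! / q^m` is smallest at `m = q`. Multiplied over the coordinates, this bounds `∏
(m j)!` below by its value at the balanced vector, without requiring `d` to divide `k`. -/
lemma factorial_mul_pow_le (q m : ℕ) : q.factorial * q ^ m ≤ m.factorial * q ^ q := by
  rcases le_total q m with h | h
  · calc q.factorial * q ^ m = (q.factorial * q ^ (m - q)) * q ^ q := by
          rw [mul_assoc, ← pow_add, Nat.sub_add_cancel h]
      _ ≤ _ := Nat.mul_le_mul_right _ (Nat.factorial_mul_pow_sub_le_factorial h)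
  · have h1 : q.factorial ≤ m.factorial * q ^ (q - m) := by
      have := factorial_add_le_factorial_mul_pow m (q - m)
      rwa [Nat.add_sub_cancel' h] at this
    calc q.factorial * q ^ m ≤ m.factorial * q ^ (q - m) * q ^ m := Nat.mul_le_mul_right _ h1
      _ = _ := by rw [mul_assoc, ← pow_add, Nat.sub_add_cancel h]

lemma factorial_pow_mul_pow_le (q : ℕ) (m : Fin d → ℕ) :
    q.factorial ^ d * q ^ ∑ j, m j ≤ (∏ j, (m j).factorial) * q ^ (d * q) := by
  have := Finset.prod_le_prod' (s := Finset.univ) fun j _ => factorial_mul_pow_le q (m j)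
  simp only [Finset.prod_mul_distrib, Finset.prod_const, Finset.card_univ, Fintype.card_fin] at this
  rwa [Finset.prod_pow_eq_pow_sum, ← pow_mul, mul_comm q d] at this

lemma factorial_le_stirling {n : ℕ} (hn : n ≠ 0) :
    (n.factorial : ℝ) ≤ Real.exp 1 * √n * (n / Real.exp 1) ^ n := by
  obtain ⟨n, rfl⟩ := Nat.exists_eq_succ_of_ne_zero hn
  have h : Stirling.stirlingSeq (n + 1) ≤ Stirling.stirlingSeq 1 :=
    Stirling.stirlingSeq'_antitone (Nat.zero_le n)
  rw [Stirling.stirlingSeq_one, Stirling.stirlingSeq, div_le_iff₀ (by positivity)] at h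
  refine h.trans_eq ?_
  rw [Real.sqrt_mul (by norm_num)]
  have : √2 ≠ (0 : ℝ) := by positivity
  field_simp

lemma sqrt_mul_pow_le_factorial (n : ℕ) : √n * (n / Real.exp 1) ^ n ≤ (n.factorial : ℝ) := by
  refine le_trans ?_ (Stirling.le_factorial_stirling n)
  gcongr
  have := Real.pi_gt_three
  nlinarith [Nat.cast_nonneg (α := ℝ) n]

/-- A multinomial probability for uniform draws is at most of order `k ^ (-(d - 1) / 2)`. -/
lemma exists_multinomial_le (d : ℕ) [NeZero d] : ∃ C : ℝ, 0 < C ∧ ∀ k : ℕ, k ≠ 0 →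
    ∀ m : Fin d → ℕ, ∑ j, m j = k →
      (k.factorial / (d ^ k * ∏ j, ((m j).factorial : ℝ)) : ℝ) ≤ C * (√k / √k ^ d) := by
  have hd0 : 0 < d := Nat.pos_of_ne_zero (NeZero.ne d)
  have hd : (0 : ℝ) < d := by exact_mod_cast hd0
  refine ⟨Real.exp 1 * Real.exp d * √(2 * d) ^ d, by positivity, fun k hk m hm => ?_⟩
  have hP : (0 : ℝ) < ∏ j, ((m j).factorial : ℝ) := Finset.prod_pos fun j _ => by positivity
  -- For `k < d` the quotient `k / d` is `0` and carries no information; bounding the probability by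
  -- `1` suffices, as `√k ≤ √(2 * d)`.
  rcases lt_or_ge k d with hkd | hkd
  · have h1 : (k.factorial / (d ^ k * ∏ j, ((m j).factorial : ℝ)) : ℝ) ≤ 1 := by
      rw [div_le_one (by positivity)]
      have h2 : (k.factorial : ℝ) ≤ d ^ k := by
        exact_mod_cast (Nat.factorial_le_pow k).trans (Nat.pow_le_pow_left hkd.le k)
      have h3 : (1 : ℝ) ≤ ∏ j, ((m j).factorial : ℝ) :=
        by exact_mod_cast Finset.one_le_prod' fun j _ => Nat.succ_le_of_lt (Nat.factorial_pos (m j))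
      exact h2.trans (le_mul_of_one_le_right (by positivity) h3)
    refine h1.trans ?_
    have h4 : √(k : ℝ) ≤ √(2 * d) := Real.sqrt_le_sqrt (by
      have : (k : ℝ) < d := by exact_mod_cast hkd
      linarith)
    have h5 : (1 : ℝ) ≤ √k := Real.one_le_sqrt.2 (by exact_mod_cast Nat.one_le_iff_ne_zero.2 hk)
    have h6 : √(k : ℝ) ^ d ≤ √(2 * d) ^ d := by gcongr
    have h7 := Real.one_le_exp (zero_le_one (α := ℝ))
    have h8 := Real.one_le_exp hd.le
    have h9 : (1 : ℝ) ≤ Real.exp 1 * Real.exp d := one_le_mul_of_one_le_of_one_le h7 h8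
    have hpos : 0 < √(k : ℝ) ^ d := by positivity
    rw [mul_div_assoc', le_div_iff₀ hpos, one_mul]
    calc √(k : ℝ) ^ d ≤ 1 * √(2 * d) ^ d * 1 := by simpa using h6
      _ ≤ _ := by gcongr
  · set q := k / d with hq
    have hq0 : 0 < q := Nat.div_pos hkd hd0
    have hdq : d * q ≤ k := Nat.mul_div_le k d
    have hkq : k < d * q + d := by
      have := Nat.lt_mul_div_succ k hd0
      rw [Nat.mul_succ] at this; exact this
    have hqR : (0 : ℝ) < q := by exact_mod_cast hq0
    have hkR : (0 : ℝ) < k := by positivity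
    have hP2 : ((q.factorial : ℝ) ^ d * q ^ k) ≤ (∏ j, ((m j).factorial : ℝ)) * q ^ (d * q) := by
      rw [← hm]; exact_mod_cast factorial_pow_mul_pow_le q m
    have hs1 : (√q * (q / Real.exp 1) ^ q) ^ d ≤ (q.factorial : ℝ) ^ d := by
      gcongr; exact sqrt_mul_pow_le_factorial q
    have hlow : √q ^ d * q ^ k / Real.exp (d * q) ≤ ∏ j, ((m j).factorial : ℝ) := by
      have h1 : (√q * (q / Real.exp 1) ^ q) ^ d * q ^ k =
          √q ^ d * q ^ k / Real.exp (d * q) * q ^ (d * q) := by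
        rw [mul_pow, ← pow_mul, div_pow, ← Real.exp_nat_mul, mul_comm q d]
        push_cast
        rw [mul_one]
        ring
      have h2 := (mul_le_mul_of_nonneg_right hs1 (by positivity : (0 : ℝ) ≤ q ^ k)).trans hP2
      rw [h1] at h2
      exact le_of_mul_le_mul_right h2 (by positivity)
    -- This absorbs the rounding of `k / d`. With `r = k - d q ≤ d`, the inequality `1 + u ≤ exp u`
    -- gives the exponent `k r / (d q) = r + r^2 / (d q)`, and the last term is at most `d`.
    have hexp : ((k : ℝ) / (d * q)) ^ k ≤ Real.exp (k - d * q) * Real.exp d := by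
      have hr0 : (0 : ℝ) ≤ k - d * q := by
        have : ((d * q : ℕ) : ℝ) ≤ k := by exact_mod_cast hdq
        push_cast at this; linarith
      have hr1 : (k : ℝ) - d * q ≤ d := by
        have : (k : ℝ) < ((d * q + d : ℕ) : ℝ) := by exact_mod_cast hkq
        push_cast at this; linarith
      have h1 : (k : ℝ) / (d * q) ≤ Real.exp ((k - d * q) / (d * q)) := by
        refine le_trans (le_of_eq ?_) (Real.add_one_le_exp _)
        field_simp
        ring
      calc ((k : ℝ) / (d * q)) ^ k ≤ Real.exp ((k - d * q) / (d * q)) ^ k := by gcongr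
        _ = Real.exp (k * ((k - d * q) / (d * q))) := (Real.exp_nat_mul _ _).symm
        _ ≤ Real.exp (k - d * q + d) := by
          rw [Real.exp_le_exp, mul_div_assoc', div_le_iff₀ (by positivity)]
          have hq1 : (1 : ℝ) ≤ q := by exact_mod_cast hq0
          have e1 : ((k : ℝ) - d * q) * (k - d * q) ≤ d * d :=
            mul_le_mul hr1 hr1 hr0 hd.le
          have e2 : (d : ℝ) * d ≤ d * d * q := le_mul_of_one_le_right (by positivity) hq1
          nlinarith
        _ = _ := Real.exp_add _ _
    have hqk : √(k : ℝ) ^ d ≤ √(2 * d) ^ d * √q ^ d := by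
      rw [← mul_pow, ← Real.sqrt_mul (by positivity)]
      gcongr
      have : k ≤ 2 * d * q := by nlinarith
      exact_mod_cast this
    have hup := factorial_le_stirling hk
    calc (k.factorial / (d ^ k * ∏ j, ((m j).factorial : ℝ)) : ℝ)
        ≤ (Real.exp 1 * √k * (k / Real.exp 1) ^ k) /
          (d ^ k * (√q ^ d * q ^ k / Real.exp (d * q))) := by gcongr
      _ = Real.exp 1 * √k * ((k : ℝ) / (d * q)) ^ k * Real.exp (d * q - k) / √q ^ d := by
          rw [div_pow, ← Real.exp_nat_mul, Real.exp_sub, div_pow, mul_pow, mul_one]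
          have := Real.exp_pos (d * q)
          have h3 : √(q : ℝ) ≠ 0 := by positivity
          field_simp
      _ ≤ Real.exp 1 * √k * (Real.exp (k - d * q) * Real.exp d) * Real.exp (d * q - k) /
            √q ^ d := by gcongr
      _ = Real.exp 1 * Real.exp d * √k / √q ^ d := by
          have : Real.exp (k - d * q) * Real.exp (d * q - k) = 1 := by
            rw [← Real.exp_add]; simp
          linear_combination (Real.exp 1 * √k * Real.exp d / √q ^ d) * this
      _ ≤ Real.exp 1 * Real.exp d * √(2 * d) ^ d * (√k / √k ^ d) := by
          have hk3 : 0 < √(k : ℝ) := by positivity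
          have hq3 : 0 < √(q : ℝ) := by positivity
          rw [mul_div_assoc', div_le_div_iff₀ (by positivity) (by positivity)]
          calc Real.exp 1 * Real.exp d * √k * √k ^ d
              ≤ Real.exp 1 * Real.exp d * √k * (√(2 * d) ^ d * √q ^ d) := by gcongr
            _ = _ := by ring

/-- The exponent is `|a - i|` written in natural numbers; each side of `a` gives at most a full
geometric series. -/
lemma sum_pow_max_sub_min_le {s : ℝ} (hs0 : 0 ≤ s) (hs1 : s < 1) (a N : ℕ) :
    ∑ i ∈ Finset.range N, s ^ (max a i - min a i) ≤ 2 / (1 - s) := by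
  have hg : ∀ n, ∑ i ∈ Finset.range n, s ^ i ≤ 1 / (1 - s) := fun n => by
    rw [one_div, ← tsum_geometric_of_lt_one hs0 hs1]
    exact (summable_geometric_of_lt_one hs0 hs1).sum_le_tsum _ fun i _ => pow_nonneg hs0 i
  have h1 : ∑ i ∈ Finset.range (a + 1), s ^ (max a i - min a i) ≤ 1 / (1 - s) := by
    rw [← Finset.sum_range_reflect]
    refine le_trans (Finset.sum_le_sum fun i hi => ?_) (hg (a + 1))
    have := Finset.mem_range.1 hi
    apply le_of_eq; congr 1; omega
  have h2 : ∑ i ∈ Finset.range N, s ^ (max a (a + 1 + i) - min a (a + 1 + i)) ≤ 1 / (1 - s) := by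
    refine le_trans (Finset.sum_le_sum fun i hi => ?_) (hg N)
    exact pow_le_pow_of_le_one hs0 hs1.le (by omega)
  calc _ ≤ ∑ i ∈ Finset.range (a + 1 + N), s ^ (max a i - min a i) :=
        Finset.sum_le_sum_of_subset_of_nonneg (Finset.range_mono (by omega))
          fun i _ _ => pow_nonneg hs0 _
    _ ≤ 1 / (1 - s) + 1 / (1 - s) := by
        rw [Finset.sum_range_add]; exact add_le_add h1 h2
    _ = _ := by ring

/-- Sum `2 max(a, b) = a + b + |a - b|` over the coordinates; the part `a + b` contributes `2 k`. -/
lemma half_pow_sum_max {s : ℝ} (hs : s ^ 2 = 1 / 2) (m m' : Fin d → ℕ) {k : ℕ}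
    (hm : ∑ j, m j = k) (hm' : ∑ j, m' j = k) :
    (1 / 2 : ℝ) ^ ∑ j, max (m j) (m' j) =
      (1 / 2) ^ k * ∏ j, s ^ (max (m j) (m' j) - min (m j) (m' j)) := by
  rw [Finset.prod_pow_eq_pow_sum, ← hs, ← pow_mul, ← pow_mul, ← pow_add]
  congr 1
  have : 2 * k = ∑ j, (m j + m' j) := by rw [Finset.sum_add_distrib, hm, hm', two_mul]
  rw [this, ← Finset.sum_add_distrib, Finset.mul_sum]
  exact Finset.sum_congr rfl fun j _ => by omega

lemma sum_half_pow_sum_max_le {s : ℝ} (hs : s ^ 2 = 1 / 2) (hs0 : 0 ≤ s) (hs1 : s < 1)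
    (m : Fin d → ℕ) {k : ℕ} (hm : ∑ j, m j = k) :
    ∑ m' ∈ Finset.piAntidiag Finset.univ k, (1 / 2 : ℝ) ^ ∑ j, max (m j) (m' j) ≤
      (1 / 2) ^ k * (2 / (1 - s)) ^ d := by
  classical
  rw [Finset.sum_congr rfl fun m' hm' =>
    half_pow_sum_max hs m m' hm (Finset.mem_piAntidiag.1 hm').1, ← Finset.mul_sum]
  refine mul_le_mul_of_nonneg_left ?_ (by positivity)
  calc _ ≤ ∑ m' ∈ Fintype.piFinset fun _ => Finset.range (k + 1),
        ∏ j, s ^ (max (m j) (m' j) - min (m j) (m' j)) := by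
        refine Finset.sum_le_sum_of_subset_of_nonneg (fun m' hm' => ?_)
          fun m' _ _ => Finset.prod_nonneg fun j _ => pow_nonneg hs0 _
        rw [Fintype.mem_piFinset]
        intro j
        rw [Finset.mem_range, Nat.lt_succ_iff, ← (Finset.mem_piAntidiag.1 hm').1]
        exact Finset.single_le_sum (f := m') (fun i _ => Nat.zero_le _) (Finset.mem_univ j)
    _ = ∏ j, ∑ i ∈ Finset.range (k + 1), s ^ (max (m j) i - min (m j) i) :=
        (Finset.prod_univ_sum (fun _ => Finset.range (k + 1))
          fun j i => s ^ (max (m j) i - min (m j) i)).symm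
    _ ≤ ∏ _j : Fin d, 2 / (1 - s) :=
        Finset.prod_le_prod (fun j _ => Finset.sum_nonneg fun i _ => pow_nonneg hs0 _)
          fun j _ => sum_pow_max_sub_min_le hs0 hs1 _ _
    _ = _ := by rw [Finset.prod_const, Finset.card_univ, Fintype.card_fin]

/-- For each fixed `m`, the weight of `m'` is replaced by the uniform multinomial bound, and the
remaining unweighted sum over `m'` is at most `2^(-k)` times a constant. -/
lemma exists_integral_centeredKernel_sq_le (d : ℕ) [NeZero d] : ∃ C : ℝ, 0 < C ∧
    ∀ k : ℕ, k ≠ 0 → ∀ x : Fin d → ℝ,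
      ∫ z in Set.Icc (0 : Fin d → ℝ) 1, centeredKernel d k x z ^ 2 ≤
        (1 / 2) ^ k * (C * (√k / √k ^ d)) := by
  obtain ⟨C, hC, h⟩ := exists_multinomial_le d
  obtain ⟨s, hs, hs0, hs1⟩ : ∃ s : ℝ, s ^ 2 = 1 / 2 ∧ 0 ≤ s ∧ s < 1 :=
    ⟨√(1 / 2), Real.sq_sqrt (by norm_num), Real.sqrt_nonneg _, by
      rw [Real.sqrt_lt' one_pos]; norm_num⟩
  have h1 : 0 < 1 - s := by linarith
  refine ⟨C * (2 / (1 - s)) ^ d, by positivity, fun k hk x => ?_⟩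
  rw [integral_centeredKernel_sq]
  refine le_trans (splitMean_mono (G := fun _ => _) fun m hm => ?_) (splitMean_const k _).le
  rw [splitMean_eq_sum]
  calc _ ≤ ∑ m' ∈ Finset.piAntidiag Finset.univ k,
        C * (√k / √k ^ d) * (1 / 2 : ℝ) ^ ∑ j, max (m j) (m' j) := by
        refine Finset.sum_le_sum fun m' hm' => ?_
        exact mul_le_mul_of_nonneg_right (h k hk m' (Finset.mem_piAntidiag.1 hm').1)
          (by positivity)
    _ ≤ C * (√k / √k ^ d) * ((1 / 2) ^ k * (2 / (1 - s)) ^ d) := by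
        rw [← Finset.mul_sum]
        exact mul_le_mul_of_nonneg_left (sum_half_pow_sum_max_le hs hs0 hs1 m hm) (by positivity)
    _ = _ := by ring

end multinomial

/-! ### Second moments of sums that are independent given the new point. -/

section independence

variable {Ω E F : Type*} [MeasurableSpace Ω] [MeasurableSpace E] [MeasurableSpace F]
  {P : Measure Ω} [IsProbabilityMeasure P] {X : Ω → E} {Z : ℕ → Ω → F} {ν : Measure F}

lemma map_prodMk_eq_prod (hX : Measurable X) (hZ : ∀ i, Measurable (Z i))
    (hν : ∀ i, P.map (Z i) = ν) (hind : IndepFun X (fun ω i => Z i ω) P) (i : ℕ) :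
    P.map (fun ω => (X ω, Z i ω)) = (P.map X).prod ν := by
  have h : IndepFun X (Z i) P := hind.comp (φ := id) (ψ := fun z : ℕ → F => z i) measurable_id
    (measurable_pi_apply i)
  rw [(indepFun_iff_map_prod_eq_prod_map_map hX.aemeasurable (hZ i).aemeasurable).1 h, hν]

lemma map_prodMk_prodMk_eq_prod (hX : Measurable X) (hZ : ∀ i, Measurable (Z i))
    (hν : ∀ i, P.map (Z i) = ν) (hind : IndepFun X (fun ω i => Z i ω) P) (hi : iIndepFun Z P)
    {i j : ℕ} (hij : i ≠ j) :
    P.map (fun ω => (X ω, (Z i ω, Z j ω))) = (P.map X).prod (ν.prod ν) := by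
  have h : IndepFun X (fun ω => (Z i ω, Z j ω)) P :=
    hind.comp (φ := id) (ψ := fun z : ℕ → F => (z i, z j)) measurable_id (by fun_prop)
  rw [(indepFun_iff_map_prod_eq_prod_map_map hX.aemeasurable
      ((hZ i).prodMk (hZ j)).aemeasurable).1 h,
    (indepFun_iff_map_prod_eq_prod_map_map (hZ i).aemeasurable (hZ j).aemeasurable).1
      (hi.indepFun hij), hν, hν]

/-- The second moment of a sum of terms that are conditionally centered and independent. -/
lemma integral_sq_sum_eq (hX : Measurable X) (hZ : ∀ i, Measurable (Z i))
    (hν : ∀ i, P.map (Z i) = ν) (hind : IndepFun X (fun ω i => Z i ω) P) (hi : iIndepFun Z P)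
    {φ : E × F → ℝ} (hφ : Measurable φ) (h2 : Integrable (fun p => φ p ^ 2) ((P.map X).prod ν))
    (h0 : ∀ x, ∫ z, φ (x, z) ∂ν = 0) (n : ℕ) :
    Integrable (fun ω => (∑ i ∈ Finset.range n, φ (X ω, Z i ω)) ^ 2) P ∧
    ∫ ω, (∑ i ∈ Finset.range n, φ (X ω, Z i ω)) ^ 2 ∂P =
      n * ∫ p, φ p ^ 2 ∂((P.map X).prod ν) := by
  have : IsProbabilityMeasure ν := hν 0 ▸ Measure.isProbabilityMeasure_map (hZ 0).aemeasurable
  have : IsProbabilityMeasure (P.map X) := Measure.isProbabilityMeasure_map hX.aemeasurable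
  have hXZ : ∀ i, Measurable fun ω => (X ω, Z i ω) := fun i => hX.prodMk (hZ i)
  have hsq : ∀ i, Integrable (fun ω => φ (X ω, Z i ω) ^ 2) P := by
    intro i
    rw [← map_prodMk_eq_prod hX hZ hν hind i] at h2
    exact h2.comp_measurable (hXZ i)
  have hL : ∀ i, MemLp (fun ω => φ (X ω, Z i ω)) 2 P := fun i =>
    (memLp_two_iff_integrable_sq (hφ.comp (hXZ i)).aestronglyMeasurable).2 (hsq i)
  have hmul : ∀ i j, Integrable (fun ω => φ (X ω, Z i ω) * φ (X ω, Z j ω)) P := fun i j =>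
    (hL i).integrable_mul (hL j)
  have hoff : ∀ i j, i ≠ j → ∫ ω, φ (X ω, Z i ω) * φ (X ω, Z j ω) ∂P = 0 := by
    intro i j hij
    have hm : Measurable fun ω => (X ω, (Z i ω, Z j ω)) := hX.prodMk ((hZ i).prodMk (hZ j))
    have hψ : Measurable fun q : E × (F × F) => φ (q.1, q.2.1) * φ (q.1, q.2.2) := by fun_prop
    have h1 := integral_map (μ := P) hm.aemeasurable hψ.aestronglyMeasurable
    have hint : Integrable (fun q : E × (F × F) => φ (q.1, q.2.1) * φ (q.1, q.2.2))
        ((P.map X).prod (ν.prod ν)) := by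
      rw [← map_prodMk_prodMk_eq_prod hX hZ hν hind hi hij,
        integrable_map_measure hψ.aestronglyMeasurable hm.aemeasurable]
      exact hmul i j
    rw [← h1, map_prodMk_prodMk_eq_prod hX hZ hν hind hi hij, integral_prod _ hint]
    -- With the new point frozen, the two factors are independent and centered, so the cross term
    -- vanishes.
    have hx : ∀ x, ∫ y, φ (x, y.1) * φ (x, y.2) ∂(ν.prod ν) = 0 := fun x => by
      rw [integral_prod_mul (fun z => φ (x, z)) fun z => φ (x, z), h0, zero_mul]
    simp [hx]
  have hdiag : ∀ i, ∫ ω, φ (X ω, Z i ω) * φ (X ω, Z i ω) ∂P =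
      ∫ p, φ p ^ 2 ∂((P.map X).prod ν) := by
    intro i
    rw [← map_prodMk_eq_prod hX hZ hν hind i, integral_map (hXZ i).aemeasurable
      (hφ.pow_const 2).aestronglyMeasurable]
    simp only [sq]
  have hexp : ∀ ω, (∑ i ∈ Finset.range n, φ (X ω, Z i ω)) ^ 2 =
      ∑ i ∈ Finset.range n, ∑ j ∈ Finset.range n, φ (X ω, Z i ω) * φ (X ω, Z j ω) := fun ω => by
    rw [sq, Finset.sum_mul_sum]
  simp only [hexp]
  refine ⟨integrable_finsetSum _ fun i _ => integrable_finsetSum _ fun j _ => hmul i j, ?_⟩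
  rw [integral_finsetSum _ fun i _ => integrable_finsetSum _ fun j _ => hmul i j]
  have : ∀ i ∈ Finset.range n, ∫ ω, ∑ j ∈ Finset.range n, φ (X ω, Z i ω) * φ (X ω, Z j ω) ∂P =
      ∫ p, φ p ^ 2 ∂((P.map X).prod ν) := by
    intro i hi'
    rw [integral_finsetSum _ fun j _ => hmul i j, Finset.sum_eq_single_of_mem i hi'
      fun j _ hj => hoff i j hj.symm, hdiag]
  rw [Finset.sum_congr rfl this]
  simp

end independence

/-! ### Deterministic control of the error of a weighted average. -/

section pointwise

lemma sq_sum_mul_div_le {ι : Type*} (s : Finset ι) {K u : ι → ℝ} (hK : ∀ i ∈ s, 0 ≤ K i)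
    (hS : 0 < ∑ i ∈ s, K i) :
    ((∑ i ∈ s, K i * u i) / ∑ i ∈ s, K i) ^ 2 ≤ (∑ i ∈ s, K i * u i ^ 2) / ∑ i ∈ s, K i := by
  have := Finset.sum_sq_le_sum_mul_sum_of_sq_le_mul s (r := fun i => K i * u i) (f := K)
    (g := fun i => K i * u i ^ 2) hK (fun i hi => mul_nonneg (hK i hi) (sq_nonneg _))
    fun i _ => by apply le_of_eq; ring
  rw [div_pow, div_le_div_iff₀ (by positivity) hS]
  nlinarith

/-- This replaces a maximal inequality: apply `u + 1 ≤ exp u` to `u = l e_i^2 - 2 log n`. The factor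
`2` produces `n^2` in the denominator, so that a sum of `n` terms of bounded mean is `O(1/n)` on
average. -/
lemma sq_le_log_add_sum_exp {n : ℕ} (hn : n ≠ 0) {l : ℝ} (hl : 0 < l) (e : ℕ → ℝ) {i : ℕ}
    (hi : i ∈ Finset.range n) : e i ^ 2 ≤
      2 / l * Real.log n + 1 / l * ∑ j ∈ Finset.range n, Real.exp (l * e j ^ 2) / n ^ 2 := by
  have hn' : (0 : ℝ) < n := by positivity
  have h1 := Real.add_one_le_exp (l * e i ^ 2 - 2 * Real.log n)
  have h2 : Real.exp (l * e i ^ 2 - 2 * Real.log n) = Real.exp (l * e i ^ 2) / n ^ 2 := by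
    rw [Real.exp_sub, two_mul, Real.exp_add, Real.exp_log hn', sq (n : ℝ)]
  have h3 : Real.exp (l * e i ^ 2) / n ^ 2 ≤
      ∑ j ∈ Finset.range n, Real.exp (l * e j ^ 2) / n ^ 2 :=
    Finset.single_le_sum (f := fun j => Real.exp (l * e j ^ 2) / (n : ℝ) ^ 2)
      (fun j _ => by positivity) hi
  rw [h2] at h1
  have h4 : l * e i ^ 2 ≤
      2 * Real.log n + ∑ j ∈ Finset.range n, Real.exp (l * e j ^ 2) / n ^ 2 := by linarith
  rw [div_mul_eq_mul_div, div_mul_eq_mul_div, one_mul, ← add_div, le_div_iff₀ hl]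
  linarith

/-- A deterministic bound on the quadratic error of a weighted average, in terms of the squared
bias, the weighted noise and the fluctuation of the total weight around `M`. -/
lemma sq_weighted_error_le {n : ℕ} (hn : n ≠ 0) {l B t M : ℝ} (hl : 0 < l) (hM : 1 ≤ M)
    {K g e : ℕ → ℝ} (hK : ∀ i, 0 ≤ K i) (hg : ∀ i, |g i| ≤ B) (ht : |t| ≤ B) :
    ((∑ i ∈ Finset.range n, (g i + e i) * K i) / (∑ i ∈ Finset.range n, K i) - t) ^ 2 ≤
      4 * ∑ i ∈ Finset.range n, K i * (g i - t) ^ 2 +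
      8 * (∑ i ∈ Finset.range n, K i * e i) ^ 2 +
      (32 * B ^ 2 + 16 / l * Real.log n) * (∑ i ∈ Finset.range n, (K i - M / n)) ^ 2 +
      2 / l * ∑ j ∈ Finset.range n, Real.exp (l * e j ^ 2) / n ^ 2 := by
  have hn' : (0 : ℝ) < n := by positivity
  have hlog : 0 ≤ Real.log n := Real.log_natCast_nonneg n
  have hSM : ∑ i ∈ Finset.range n, (K i - M / n) = ∑ i ∈ Finset.range n, K i - M := by
    rw [Finset.sum_sub_distrib]; simp; field_simp
  rw [hSM]
  set S := ∑ i ∈ Finset.range n, K i with hS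
  set W := ∑ j ∈ Finset.range n, Real.exp (l * e j ^ 2) / n ^ 2 with hW
  have hW0 : 0 ≤ W := Finset.sum_nonneg fun j _ => by positivity
  have hA0 : 0 ≤ ∑ i ∈ Finset.range n, K i * (g i - t) ^ 2 :=
    Finset.sum_nonneg fun i _ => mul_nonneg (hK i) (sq_nonneg _)
  have hS0 : 0 ≤ S := Finset.sum_nonneg fun i _ => hK i
  have hlW : 0 ≤ 2 / l * W := by positivity
  have hll : 0 ≤ 16 / l * Real.log n := by positivity
  have hB : t ^ 2 ≤ B ^ 2 := sq_le_sq' (by linarith [abs_le.1 ht]) (abs_le.1 ht).2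
  rcases lt_or_ge S (1 / 2) with hlt | hge
  -- Too small a weight forces a fluctuation `|S - M| ≥ 1/2`, since `M ≥ 1`.
  · have h4 : 1 ≤ 4 * (S - M) ^ 2 := by nlinarith
    have hkey : ((∑ i ∈ Finset.range n, (g i + e i) * K i) / S - t) ^ 2 ≤
        8 * B ^ 2 + 4 / l * Real.log n + 2 / l * W := by
      -- If all weights vanish, the quotient is `0` and the squared error is `t ^ 2 ≤ B ^ 2`.
      rcases hS0.eq_or_lt with h0 | hpos
      · rw [← h0]
        have : 0 ≤ 4 / l * Real.log n := by positivity
        simp only [div_zero, zero_sub, neg_sq]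
        nlinarith [sq_nonneg B]
      · have h5 : (∑ i ∈ Finset.range n, (g i + e i) * K i) / S - t =
            (∑ i ∈ Finset.range n, K i * (g i + e i - t)) / S := by
          rw [div_sub' hpos.ne']
          congr 1
          rw [hS, Finset.sum_mul, ← Finset.sum_sub_distrib]
          exact Finset.sum_congr rfl fun i _ => by ring
        rw [h5]
        refine (sq_sum_mul_div_le _ (fun i _ => hK i) hpos).trans ?_
        rw [div_le_iff₀ hpos, hS, Finset.mul_sum]
        refine Finset.sum_le_sum fun i hi => ?_
        rw [mul_comm]
        refine mul_le_mul_of_nonneg_right ?_ (hK i)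
        have h6 := sq_le_log_add_sum_exp hn hl e hi
        have h7 : (g i - t) ^ 2 ≤ (2 * B) ^ 2 := by
          have := abs_le.1 (hg i)
          have := abs_le.1 ht
          exact sq_le_sq' (by linarith) (by linarith)
        rw [← hW] at h6
        have h8 : (g i + e i - t) ^ 2 ≤ 2 * (g i - t) ^ 2 + 2 * e i ^ 2 := by
          nlinarith [sq_nonneg (g i - t - e i)]
        have h9 : 2 * (2 / l * Real.log n + 1 / l * W) = 4 / l * Real.log n + 2 / l * W := by ring
        nlinarith
    have h10 : 8 * B ^ 2 + 4 / l * Real.log n ≤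
        (8 * B ^ 2 + 4 / l * Real.log n) * (4 * (S - M) ^ 2) :=
      le_mul_of_one_le_right (by positivity) h4
    have h11 : (8 * B ^ 2 + 4 / l * Real.log n) * (4 * (S - M) ^ 2) =
        (32 * B ^ 2 + 16 / l * Real.log n) * (S - M) ^ 2 := by ring
    have h12 := sq_nonneg (∑ i ∈ Finset.range n, K i * e i)
    linarith
  -- Here dividing by `S` costs at most a factor `2`, so bias and noise are treated separately.
  · have hpos : 0 < S := by linarith
    have h5 : (∑ i ∈ Finset.range n, (g i + e i) * K i) / S - t =
        (∑ i ∈ Finset.range n, K i * (g i - t)) / S +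
          (∑ i ∈ Finset.range n, K i * e i) / S := by
      rw [← add_div, div_sub' hpos.ne']
      congr 1
      rw [hS, Finset.sum_mul, ← Finset.sum_sub_distrib, ← Finset.sum_add_distrib]
      exact Finset.sum_congr rfl fun i _ => by ring
    have h6 := sq_sum_mul_div_le (Finset.range n) (u := fun i => g i - t) (fun i _ => hK i) hpos
    have h7 : (∑ i ∈ Finset.range n, K i * (g i - t) ^ 2) / S ≤
        2 * ∑ i ∈ Finset.range n, K i * (g i - t) ^ 2 := by
      rw [div_le_iff₀ hpos]; nlinarith
    have h8 : ((∑ i ∈ Finset.range n, K i * e i) / S) ^ 2 ≤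
        4 * (∑ i ∈ Finset.range n, K i * e i) ^ 2 := by
      rw [div_pow, div_le_iff₀ (by positivity)]
      have h9 : 1 ≤ 4 * S ^ 2 := by nlinarith
      nlinarith [mul_le_mul_of_nonneg_left h9 (sq_nonneg (∑ i ∈ Finset.range n, K i * e i))]
    rw [h5]
    have h9 : 0 ≤ (32 * B ^ 2 + 16 / l * Real.log n) * (S - M) ^ 2 := by positivity
    rw [← hS] at h6
    nlinarith [sq_nonneg ((∑ i ∈ Finset.range n, K i * (g i - t)) / S -
          (∑ i ∈ Finset.range n, K i * e i) / S)]

end pointwise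

/-! ### Conversion of the bounds in `k` into powers of `log n`. -/

section rates

lemma half_le_log_two : (1 / 2 : ℝ) ≤ Real.log 2 := by
  have := Real.log_two_gt_d9; norm_num at *; linarith

/-- Since `log 2 < 1`, powers of `log n` are not monotone in the exponent at `n = 2`; doubling the
base restores monotonicity at the price of a constant. -/
lemma rpow_le_mul_rpow_of_half_le {a b t : ℝ} (hab : a ≤ b) (ht : 1 / 2 ≤ t) :
    t ^ a ≤ 2 ^ (b - a) * t ^ b := by
  have ht0 : 0 < t := by linarith
  have h : (2 * t) ^ a ≤ (2 * t) ^ b := Real.rpow_le_rpow_of_exponent_le (by linarith) hab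
  rw [Real.mul_rpow (by norm_num) ht0.le, Real.mul_rpow (by norm_num) ht0.le] at h
  rw [Real.rpow_sub (by norm_num), div_mul_eq_mul_div, le_div_iff₀ (by positivity)]
  linarith

lemma log_le_two_mul_nat_log {n : ℕ} (hn : 2 ≤ n) : Real.log n ≤ 2 * (Nat.log 2 n : ℝ) := by
  have h1 : (n : ℝ) ≤ 2 ^ (Nat.log 2 n + 1) := by
    exact_mod_cast (Nat.lt_pow_succ_log_self (by norm_num) n).le
  have h2 : (1 : ℝ) ≤ Nat.log 2 n := by exact_mod_cast Nat.log_pos (by norm_num) hn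
  have h3 := Real.log_le_log (by positivity) h1
  rw [Real.log_pow] at h3
  have h4 : Real.log 2 < 1 := by have := Real.log_two_lt_d9; linarith
  push_cast at h3
  nlinarith

lemma half_le_log {n : ℕ} (hn : 2 ≤ n) : (1 / 2 : ℝ) ≤ Real.log n :=
  half_le_log_two.trans (Real.log_le_log (by norm_num) (by exact_mod_cast hn))

lemma exists_sqrt_div_pow_le (d : ℕ) [NeZero d] : ∃ C : ℝ, 0 < C ∧ ∀ n : ℕ, 2 ≤ n →
    √(Nat.log 2 n : ℝ) / √(Nat.log 2 n : ℝ) ^ d ≤ C * Real.log n ^ ((1 - d : ℝ) / 2) := by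
  have hd : (1 : ℝ) ≤ d := by exact_mod_cast Nat.one_le_iff_ne_zero.2 (NeZero.ne d)
  refine ⟨(1 / 2) ^ ((1 - d : ℝ) / 2), by positivity, fun n hn => ?_⟩
  have h2 : (0 : ℝ) < Nat.log 2 n := by exact_mod_cast Nat.log_pos (by norm_num) hn
  have h1 := log_le_two_mul_nat_log hn
  have h3 := half_le_log hn
  have h4 : √(Nat.log 2 n : ℝ) / √(Nat.log 2 n : ℝ) ^ d =
      (Nat.log 2 n : ℝ) ^ ((1 - d : ℝ) / 2) := by
    rw [Real.sqrt_eq_rpow, ← Real.rpow_natCast, ← Real.rpow_mul h2.le, ← Real.rpow_sub h2]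
    congr 1; ring
  rw [h4, ← Real.mul_rpow (by norm_num) (by linarith)]
  exact Real.rpow_le_rpow_of_nonpos (by linarith) (by linarith) (by linarith)

lemma exists_pow_nat_log_le {r : ℝ} (hr0 : 0 ≤ r) (hr1 : r < 1) (s : ℝ) :
    ∃ C : ℝ, 0 < C ∧ ∀ n : ℕ, 2 ≤ n → r ^ Nat.log 2 n ≤ C * Real.log n ^ s := by
  obtain ⟨N, hN⟩ := exists_nat_ge (-s)
  have hlim := tendsto_pow_const_mul_const_pow_of_abs_lt_one N (r := r) (by rwa [abs_of_nonneg hr0])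
  obtain ⟨A, hA⟩ := hlim.bddAbove_range
  refine ⟨2 ^ N * (|A| + 1) * 2 ^ (s - (-N : ℝ)), by positivity, fun n hn => ?_⟩
  have h2 : (0 : ℝ) < Nat.log 2 n := by exact_mod_cast Nat.log_pos (by norm_num) hn
  have h1 := log_le_two_mul_nat_log hn
  have h3 := half_le_log hn
  have hlog : 0 < Real.log n := by linarith
  have h4 : (Nat.log 2 n : ℝ) ^ N * r ^ Nat.log 2 n ≤ A := hA ⟨Nat.log 2 n, rfl⟩
  have h5 : (Real.log n / 2) ^ N * r ^ Nat.log 2 n ≤ |A| + 1 := by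
    have : (Real.log n / 2) ^ N ≤ (Nat.log 2 n : ℝ) ^ N := by gcongr; linarith
    nlinarith [le_abs_self A, pow_nonneg hr0 (Nat.log 2 n)]
  have h6 : r ^ Nat.log 2 n ≤ 2 ^ N * (|A| + 1) * Real.log n ^ (-N : ℝ) := by
    rw [Real.rpow_neg hlog.le, Real.rpow_natCast, ← div_eq_mul_inv, le_div_iff₀ (by positivity)]
    rw [div_pow, div_mul_eq_mul_div, div_le_iff₀ (by positivity)] at h5
    linarith
  refine h6.trans ?_
  rw [mul_assoc (2 ^ N * (|A| + 1))]
  gcongr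
  exact rpow_le_mul_rpow_of_half_le (by linarith) h3

lemma exists_rate_le (d : ℕ) [NeZero d] {r : ℝ} (hr0 : 0 ≤ r) (hr1 : r < 1) {a b c e : ℝ}
    (ha : 0 ≤ a) (hb : 0 ≤ b) (hc : 0 ≤ c) (he : 0 ≤ e) :
    ∃ C : ℝ, 0 < C ∧ ∀ n : ℕ, 2 ≤ n →
      a * r ^ Nat.log 2 n +
        (b + c * Real.log n) * (√(Nat.log 2 n : ℝ) / √(Nat.log 2 n : ℝ) ^ d) + e / n ≤
      C * Real.log n ^ (-((d : ℝ) - 11) / 6) := by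
  have hd : (1 : ℝ) ≤ d := by exact_mod_cast Nat.one_le_iff_ne_zero.2 (NeZero.ne d)
  set s : ℝ := -((d : ℝ) - 11) / 6 with hs
  obtain ⟨C1, hC1, h1⟩ := exists_pow_nat_log_le hr0 hr1 s
  obtain ⟨C2, hC2, h2⟩ := exists_pow_nat_log_le (r := 1 / 2) (by norm_num) (by norm_num) s
  obtain ⟨C3, hC3, h3⟩ := exists_sqrt_div_pow_le d
  refine ⟨a * C1 + (2 * b + c) * (C3 * 2 ^ (s - (3 - d : ℝ) / 2)) + e * C2 + 1, by positivity,
    fun n hn => ?_⟩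
  have hlog := half_le_log hn
  have hlog0 : 0 < Real.log n := by linarith
  have hn0 : (0 : ℝ) < n := by positivity
  have hp : 0 < Real.log n ^ s := by positivity
  have e1 : a * r ^ Nat.log 2 n ≤ a * (C1 * Real.log n ^ s) := by gcongr; exact h1 n hn
  have e2 : e / n ≤ e * (C2 * Real.log n ^ s) := by
    rw [div_eq_mul_one_div]
    gcongr
    refine le_trans ?_ (h2 n hn)
    rw [one_div_pow]
    gcongr
    exact_mod_cast Nat.pow_log_le_self 2 (by omega : n ≠ 0)
  have e3 : (b + c * Real.log n) * (√(Nat.log 2 n : ℝ) / √(Nat.log 2 n : ℝ) ^ d) ≤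
      (2 * b + c) * (C3 * 2 ^ (s - (3 - d : ℝ) / 2)) * Real.log n ^ s := by
    calc _ ≤ ((2 * b + c) * Real.log n) * (C3 * Real.log n ^ ((1 - d : ℝ) / 2)) := by
          gcongr
          · nlinarith
          · exact h3 n hn
      _ = (2 * b + c) * C3 * Real.log n ^ ((3 - d : ℝ) / 2) := by
          rw [show (3 - d : ℝ) / 2 = 1 + (1 - d) / 2 by ring, Real.rpow_add hlog0, Real.rpow_one]
          ring
      _ ≤ (2 * b + c) * C3 * (2 ^ (s - (3 - d : ℝ) / 2) * Real.log n ^ s) := by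
          gcongr
          -- The true exponent `(3 - d) / 2` is at most `(11 - d) / 6` for every `d ≥ 1`; here the
          -- rate is weakened to the stated one.
          exact rpow_le_mul_rpow_of_half_le (by rw [hs]; linarith) hlog
      _ = _ := by ring
  linarith

end rates

/-! ### Moments of weight, noise and bias in the regression model. -/

lemma integral_le_of_ae_le {α : Type*} [MeasurableSpace α] {μ : Measure α}
    [IsProbabilityMeasure μ] {f : α → ℝ} {c : ℝ} (hc : 0 ≤ c) (h : ∀ᵐ x ∂μ, f x ≤ c) :
    ∫ x, f x ∂μ ≤ c := by
  by_cases hf : Integrable f μ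
  · simpa using integral_mono_ae hf (integrable_const c) h
  -- A non-integrable function has integral `0`, which is why `0 ≤ c` is assumed.
  · rwa [integral_undef hf]

lemma measurable_centeredKernel_right {d : ℕ} [NeZero d] (k : ℕ) (x : Fin d → ℝ) :
    Measurable (centeredKernel d k x) :=
  Measurable.of_uncurry_left (f := centeredKernel d k) (measurable_centeredKernel k)

namespace GaussianRegressionModel

variable {Ω : Type*} [MeasurableSpace Ω] {P : Measure Ω} {d : ℕ}
  {f g : (Fin d → ℝ) → ℝ} {σ : ℝ≥0} {X : Ω → Fin d → ℝ} {Y : Ω → ℝ}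
  {Xs : ℕ → Ω → Fin d → ℝ} {Ys : ℕ → Ω → ℝ}

lemma ae_mem_Icc (h : GaussianRegressionModel P f σ X Y Xs Ys) :
    ∀ᵐ ω ∂P, X ω ∈ Set.Icc 0 1 := by
  have h1 : ∀ᵐ x ∂(P.map X), x ∈ Set.Icc 0 1 := by
    rw [h.uniform_X]; exact ae_restrict_mem measurableSet_Icc
  exact ae_of_ae_map h.measurable_X.aemeasurable h1

/-- This allows the regression function to be modified off the cube, so that it becomes measurable
and bounded everywhere. -/
lemma congr (h : GaussianRegressionModel P f σ X Y Xs Ys)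
    (hfg : ∀ x ∈ Set.Icc (0 : Fin d → ℝ) 1, f x = g x) :
    GaussianRegressionModel P g σ X Y Xs Ys := by
  have hX : ∀ᵐ ω ∂P, f (X ω) = g (X ω) := h.ae_mem_Icc.mono fun ω hω => hfg _ hω
  refine { h with regression := h.regression.trans hX, gaussian_noise := ?_ }
  rw [← h.gaussian_noise]
  exact Measure.map_congr (hX.mono fun ω hω => by simp only [hω])

variable (h : GaussianRegressionModel P g σ X Y Xs Ys)

include h

lemma measurable_pair : Measurable fun ω => (X ω, Y ω) := h.measurable_X.prodMk h.measurable_Y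

lemma measurable_pairs (i : ℕ) : Measurable fun ω => (Xs i ω, Ys i ω) :=
  (h.measurable_Xs i).prodMk (h.measurable_Ys i)

lemma map_fst : (P.map fun ω => (X ω, Y ω)).map Prod.fst = volume.restrict (Set.Icc 0 1) := by
  rw [Measure.map_map measurable_fst h.measurable_pair, ← h.uniform_X]
  rfl

lemma map_noise (hg : Measurable g) :
    (P.map fun ω => (X ω, Y ω)).map (fun q => q.2 - g q.1) = gaussianReal 0 (σ ^ 2) := by
  rw [Measure.map_map (by fun_prop) h.measurable_pair, ← h.gaussian_noise]
  rfl

lemma integral_comp_fst {F : (Fin d → ℝ) → ℝ} (hF : Measurable F) :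
    ∫ q, F q.1 ∂(P.map fun ω => (X ω, Y ω)) = ∫ z in Set.Icc 0 1, F z := by
  rw [← h.map_fst, integral_map measurable_fst.aemeasurable hF.aestronglyMeasurable]

lemma integrable_noise_sq (hg : Measurable g) :
    Integrable (fun q => (q.2 - g q.1) ^ 2) (P.map fun ω => (X ω, Y ω)) := by
  have h1 : Integrable (fun x : ℝ => x ^ 2) (gaussianReal 0 (σ ^ 2)) :=
    (memLp_id_gaussianReal' (μ := 0) (v := σ ^ 2) 2 (by simp)).integrable_sq
  rw [← h.map_noise hg] at h1
  exact h1.comp_measurable (by fun_prop)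

lemma integral_noise_sq (hg : Measurable g) :
    ∫ q, (q.2 - g q.1) ^ 2 ∂(P.map fun ω => (X ω, Y ω)) = σ ^ 2 := by
  have h1 : ∫ x : ℝ, x ^ 2 ∂(gaussianReal 0 (σ ^ 2)) = σ ^ 2 := by
    have := variance_fun_id_gaussianReal (μ := 0) (v := σ ^ 2)
    rw [variance_eq_integral (by fun_prop), integral_id_gaussianReal] at this
    simpa using this
  rw [← h.map_noise hg, integral_map (Measurable.aemeasurable (by fun_prop))
    (Measurable.aestronglyMeasurable (by fun_prop))] at h1
  exact h1

lemma integrable_noise (hg : Measurable g) : Integrable (fun ω => Y ω - g (X ω)) P := by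
  have h1 : Integrable (fun x : ℝ => x) (gaussianReal 0 (σ ^ 2)) :=
    (memLp_id_gaussianReal' (μ := 0) (v := σ ^ 2) 1 (by simp)).integrable (by simp)
  rw [← h.gaussian_noise] at h1
  exact h1.comp_measurable (h.measurable_Y.sub (hg.comp h.measurable_X))

lemma integral_exp_noise (hg : Measurable g) {l : ℝ}
    (hl : Integrable (fun x : ℝ => Real.exp (l * x ^ 2)) (gaussianReal 0 (σ ^ 2))) (i : ℕ) :
    Integrable (fun ω => Real.exp (l * (Ys i ω - g (Xs i ω)) ^ 2)) P ∧
    ∫ ω, Real.exp (l * (Ys i ω - g (Xs i ω)) ^ 2) ∂P =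
      ∫ x, Real.exp (l * x ^ 2) ∂(gaussianReal 0 (σ ^ 2)) := by
  have hm : Measurable fun ω => Ys i ω - g (Xs i ω) :=
    (h.measurable_Ys i).sub (hg.comp (h.measurable_Xs i))
  have hmap : P.map (fun ω => Ys i ω - g (Xs i ω)) = gaussianReal 0 (σ ^ 2) := by
    rw [← h.gaussian_noise]
    exact ((h.identDistrib i).comp (u := fun q => q.2 - g q.1) (by fun_prop)).map_eq
  rw [← hmap] at hl ⊢
  refine ⟨hl.comp_measurable hm, ?_⟩
  rw [integral_map hm.aemeasurable (Measurable.aestronglyMeasurable (by fun_prop))]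

variable [IsProbabilityMeasure P]

lemma isProbabilityMeasure_map_pair : IsProbabilityMeasure (P.map fun ω => (X ω, Y ω)) :=
  Measure.isProbabilityMeasure_map h.measurable_pair.aemeasurable

/-- The noise is conditionally centered. -/
lemma integral_mul_noise (hg : Measurable g) {B : ℝ} (hB : ∀ x, |g x| ≤ B)
    {w : (Fin d → ℝ) → ℝ} (hw : Measurable w) {c : ℝ} (hc : ∀ x, |w x| ≤ c) :
    ∫ q, w q.1 * (q.2 - g q.1) ∂(P.map fun ω => (X ω, Y ω)) = 0 := by
  have hgX : Measurable fun ω => g (X ω) := hg.comp h.measurable_X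
  have hwX : Measurable fun ω => w (X ω) := hw.comp h.measurable_X
  have hgi : Integrable (fun ω => g (X ω)) P :=
    Integrable.of_bound hgX.aestronglyMeasurable B (ae_of_all _ fun ω => hB _)
  have hY : Integrable Y P := by
    refine ((h.integrable_noise hg).add hgi).congr (ae_of_all _ fun ω => ?_)
    simp
  have hwY : Integrable (fun ω => w (X ω) * Y ω) P :=
    hY.bdd_mul hwX.aestronglyMeasurable (c := c) (ae_of_all _ fun ω => hc _)
  have hwg : Integrable (fun ω => w (X ω) * g (X ω)) P :=
    hgi.bdd_mul hwX.aestronglyMeasurable (c := c) (ae_of_all _ fun ω => hc _)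
  have hle := h.measurable_X.comap_le
  have hsm : StronglyMeasurable[MeasurableSpace.comap X inferInstance] fun ω => w (X ω) :=
    (hw.comp (comap_measurable X)).stronglyMeasurable
  -- `w (X)` is pulled out of the conditional expectation, and `Y` is then replaced by its
  -- regression function.
  have h1 := condExp_mul_of_stronglyMeasurable_left hsm hwY hY
  have h2 : ∫ ω, w (X ω) * Y ω ∂P = ∫ ω, w (X ω) * g (X ω) ∂P := by
    have h3 := integral_condExp (μ := P) (f := (fun ω => w (X ω)) * Y) hle
    rw [show ∫ ω, w (X ω) * Y ω ∂P = ∫ ω, ((fun ω => w (X ω)) * Y) ω ∂P from rfl, ← h3]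
    refine integral_congr_ae (h1.trans ?_)
    filter_upwards [h.regression] with ω hω
    rw [Pi.mul_apply, hω]
  rw [integral_map h.measurable_pair.aemeasurable
    (Measurable.aestronglyMeasurable (by fun_prop))]
  simp only [mul_sub]
  rw [integral_sub hwY hwg, h2, sub_self]

variable [NeZero d]

/-- The fluctuation of the total weight of the forest. -/
lemma integral_sq_weight_sub_le {k : ℕ} {V : ℝ}
    (hV : ∀ x : Fin d → ℝ, ∫ z in Set.Icc (0 : Fin d → ℝ) 1, centeredKernel d k x z ^ 2 ≤ V)
    (n : ℕ) :
    Integrable (fun ω => (∑ i ∈ Finset.range n,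
      (centeredKernel d k (X ω) (Xs i ω) - (1 / 2) ^ k)) ^ 2) P ∧
    ∫ ω, (∑ i ∈ Finset.range n, (centeredKernel d k (X ω) (Xs i ω) - (1 / 2) ^ k)) ^ 2 ∂P ≤
      n * V := by
  have := h.isProbabilityMeasure_map_pair
  have : IsProbabilityMeasure (P.map X) :=
    Measure.isProbabilityMeasure_map h.measurable_X.aemeasurable
  have hKm := measurable_centeredKernel (d := d) k
  have hKx : ∀ x, Measurable (centeredKernel d k x) := measurable_centeredKernel_right k
  have hKi : ∀ x, Integrable (centeredKernel d k x) (volume.restrict (Set.Icc 0 1)) := fun x =>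
    Integrable.of_bound (hKx x).aestronglyMeasurable 1 (ae_of_all _ fun z => by
      rw [Real.norm_of_nonneg (centeredKernel_nonneg k x z)]; exact centeredKernel_le_one k x z)
  have hKi2 : ∀ x, Integrable (fun z => centeredKernel d k x z ^ 2)
      (volume.restrict (Set.Icc 0 1)) := fun x =>
    Integrable.of_bound ((hKx x).pow_const 2).aestronglyMeasurable 1 (ae_of_all _ fun z => by
      rw [Real.norm_of_nonneg (sq_nonneg _)]
      exact pow_le_one₀ (centeredKernel_nonneg k x z) (centeredKernel_le_one k x z))
  have hV0 : 0 ≤ V := (integral_nonneg fun z => sq_nonneg _).trans (hV 0)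
  set φ : (Fin d → ℝ) × ((Fin d → ℝ) × ℝ) → ℝ :=
    fun p => centeredKernel d k p.1 p.2.1 - (1 / 2) ^ k with hφ
  have hφm : Measurable φ :=
    (hKm.comp (measurable_fst.prodMk (measurable_fst.comp measurable_snd))).sub_const _
  have hφi : Integrable (fun p => φ p ^ 2)
      ((P.map X).prod (P.map fun ω => (X ω, Y ω))) :=
    Integrable.of_bound (hφm.pow_const 2).aestronglyMeasurable 1 (ae_of_all _ fun p => by
      rw [Real.norm_of_nonneg (sq_nonneg _), sq_le_one_iff_abs_le_one, abs_le]
      have h1 := centeredKernel_nonneg k p.1 p.2.1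
      have h2 := centeredKernel_le_one k p.1 p.2.1
      have h3 : (1 / 2 : ℝ) ^ k ≤ 1 := pow_le_one₀ (by norm_num) (by norm_num)
      have h4 : (0 : ℝ) < (1 / 2) ^ k := by positivity
      constructor <;> simp only [hφ] <;> linarith)
  have hφ0 : ∀ x, ∫ q, φ (x, q) ∂(P.map fun ω => (X ω, Y ω)) = 0 := fun x => by
    rw [h.integral_comp_fst (F := fun z => centeredKernel d k x z - (1 / 2) ^ k)
      ((hKx x).sub_const _), integral_sub (hKi x) (integrable_const _), integral_centeredKernel]
    simp
  obtain ⟨h1, h2⟩ := integral_sq_sum_eq h.measurable_X h.measurable_pairs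
    (fun i => (h.identDistrib i).map_eq) h.indep h.iIndep hφm hφi hφ0 n
  refine ⟨h1, h2.trans_le ?_⟩
  gcongr
  rw [integral_prod _ hφi]
  refine integral_le_of_ae_le hV0 (ae_of_all _ fun x => ?_)
  refine le_trans ?_ (hV x)
  rw [h.integral_comp_fst (F := fun z => (centeredKernel d k x z - (1 / 2) ^ k) ^ 2)
    (((hKx x).sub_const _).pow_const 2)]
  have h3 : ∀ z, (centeredKernel d k x z - (1 / 2) ^ k) ^ 2 = centeredKernel d k x z ^ 2 -
      (2 * (1 / 2) ^ k) * centeredKernel d k x z + ((1 / 2) ^ k) ^ 2 := fun z => by ring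
  simp only [h3]
  have h4 : Integrable (fun z => centeredKernel d k x z ^ 2 -
      (2 * (1 / 2) ^ k) * centeredKernel d k x z) (volume.restrict (Set.Icc 0 1)) :=
    (hKi2 x).sub ((hKi x).const_mul _)
  rw [integral_add h4 (integrable_const _), integral_sub (hKi2 x) ((hKi x).const_mul _), integral_const_mul, integral_centeredKernel]
  simp only [integral_const, probReal_univ, smul_eq_mul, one_mul]
  -- The variance is at most the second moment.
  nlinarith [sq_nonneg ((1 / 2 : ℝ) ^ k)]

/-- The contribution of the noise. -/
lemma integral_sq_weighted_noise_le (hg : Measurable g) {B : ℝ} (hB : ∀ x, |g x| ≤ B) {k : ℕ}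
    {V : ℝ}
    (hV : ∀ x : Fin d → ℝ, ∫ z in Set.Icc (0 : Fin d → ℝ) 1, centeredKernel d k x z ^ 2 ≤ V)
    (n : ℕ) :
    Integrable (fun ω => (∑ i ∈ Finset.range n,
      centeredKernel d k (X ω) (Xs i ω) * (Ys i ω - g (Xs i ω))) ^ 2) P ∧
    ∫ ω, (∑ i ∈ Finset.range n,
      centeredKernel d k (X ω) (Xs i ω) * (Ys i ω - g (Xs i ω))) ^ 2 ∂P ≤ n * (σ ^ 2 * V) := by
  have := h.isProbabilityMeasure_map_pair
  have : IsProbabilityMeasure (P.map X) :=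
    Measure.isProbabilityMeasure_map h.measurable_X.aemeasurable
  have hKm := measurable_centeredKernel (d := d) k
  have hKx : ∀ x, Measurable (centeredKernel d k x) := measurable_centeredKernel_right k
  set φ : (Fin d → ℝ) × ((Fin d → ℝ) × ℝ) → ℝ :=
    fun p => centeredKernel d k p.1 p.2.1 * (p.2.2 - g p.2.1) with hφ
  have hφm : Measurable φ :=
    (hKm.comp (measurable_fst.prodMk (measurable_fst.comp measurable_snd))).mul (by fun_prop)
  have hφi : Integrable (fun p => φ p ^ 2)
      ((P.map X).prod (P.map fun ω => (X ω, Y ω))) := by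
    refine ((h.integrable_noise_sq hg).comp_snd (P.map X)).mono'
      (hφm.pow_const 2).aestronglyMeasurable (ae_of_all _ fun p => ?_)
    rw [Real.norm_of_nonneg (sq_nonneg _), hφ]
    simp only [mul_pow]
    exact mul_le_of_le_one_left (sq_nonneg _)
      (pow_le_one₀ (centeredKernel_nonneg k _ _) (centeredKernel_le_one k _ _))
  have hφ0 : ∀ x, ∫ q, φ (x, q) ∂(P.map fun ω => (X ω, Y ω)) = 0 := fun x =>
    h.integral_mul_noise hg hB (hKx x) (c := 1) fun z => by
      rw [abs_of_nonneg (centeredKernel_nonneg k x z)]; exact centeredKernel_le_one k x z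
  obtain ⟨h1, h2⟩ := integral_sq_sum_eq h.measurable_X h.measurable_pairs
    (fun i => (h.identDistrib i).map_eq) h.indep h.iIndep hφm hφi hφ0 n
  refine ⟨h1, h2.trans_le ?_⟩
  gcongr
  -- The new point is integrated first: the squared noise then factors out, and symmetry of the
  -- kernel bounds the rest by `V`. No assumption on the conditional variance of the noise given the
  -- design point is needed.
  rw [integral_prod_symm _ hφi]
  have hmem : ∀ᵐ q ∂(P.map fun ω => (X ω, Y ω)), q.1 ∈ Set.Icc 0 1 := by
    have h3 : ∀ᵐ x ∂((P.map fun ω => (X ω, Y ω)).map Prod.fst), x ∈ Set.Icc 0 1 := by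
      rw [h.map_fst]; exact ae_restrict_mem measurableSet_Icc
    exact ae_of_ae_map measurable_fst.aemeasurable h3
  have hle : ∀ᵐ q ∂(P.map fun ω => (X ω, Y ω)),
      ∫ x, φ (x, q) ^ 2 ∂(P.map X) ≤ V * (q.2 - g q.1) ^ 2 := by
    filter_upwards [hmem] with q hq
    simp only [hφ, mul_pow]
    rw [integral_mul_const, h.uniform_X]
    gcongr
    refine le_trans (le_of_eq ?_) (hV q.1)
    refine setIntegral_congr_fun measurableSet_Icc fun x hx => ?_
    simp only [centeredKernel_comm k hx hq]
  refine (integral_mono_ae hφi.integral_prod_right ((h.integrable_noise_sq hg).const_mul V)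
    hle).trans_eq ?_
  rw [integral_const_mul, h.integral_noise_sq hg, mul_comm]

/-- The contribution of the bias. -/
lemma integral_weighted_bias_le (hg : Measurable g) {B L : ℝ} (hB : ∀ x, |g x| ≤ B)
    (hL : ∀ x ∈ Set.Icc (0 : Fin d → ℝ) 1, ∀ y ∈ Set.Icc (0 : Fin d → ℝ) 1,
      |g x - g y| ≤ L * √(∑ j, (x j - y j) ^ 2)) (k i : ℕ) :
    Integrable (fun ω => centeredKernel d k (X ω) (Xs i ω) * (g (Xs i ω) - g (X ω)) ^ 2) P ∧
    ∫ ω, centeredKernel d k (X ω) (Xs i ω) * (g (Xs i ω) - g (X ω)) ^ 2 ∂P ≤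
      L ^ 2 * d * ((1 / 2) ^ k * (1 - 3 / (4 * d)) ^ k) := by
  have := h.isProbabilityMeasure_map_pair
  have : IsProbabilityMeasure (P.map X) :=
    Measure.isProbabilityMeasure_map h.measurable_X.aemeasurable
  have hd : (1 : ℝ) ≤ d := by exact_mod_cast Nat.one_le_iff_ne_zero.2 (NeZero.ne d)
  have hr : (0 : ℝ) ≤ 1 - 3 / (4 * d) := by
    rw [sub_nonneg, div_le_one (by positivity)]; linarith
  have hKm := measurable_centeredKernel (d := d) k
  set ψ : (Fin d → ℝ) × ((Fin d → ℝ) × ℝ) → ℝ :=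
    fun p => centeredKernel d k p.1 p.2.1 * (g p.2.1 - g p.1) ^ 2 with hψ
  have hψm : Measurable ψ :=
    (hKm.comp (measurable_fst.prodMk (measurable_fst.comp measurable_snd))).mul (by fun_prop)
  have hψi : Integrable ψ ((P.map X).prod (P.map fun ω => (X ω, Y ω))) :=
    Integrable.of_bound hψm.aestronglyMeasurable ((2 * B) ^ 2) (ae_of_all _ fun p => by
      rw [Real.norm_of_nonneg (mul_nonneg (centeredKernel_nonneg k _ _) (sq_nonneg _))]
      refine (mul_le_of_le_one_left (sq_nonneg _) (centeredKernel_le_one k _ _)).trans ?_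
      have h1 := abs_le.1 (hB p.2.1)
      have h2 := abs_le.1 (hB p.1)
      exact sq_le_sq' (by linarith) (by linarith))
  have hmap := map_prodMk_eq_prod h.measurable_X h.measurable_pairs
    (fun i => (h.identDistrib i).map_eq) h.indep i
  have hmeas : Measurable fun ω => (X ω, (Xs i ω, Ys i ω)) :=
    h.measurable_X.prodMk (h.measurable_pairs i)
  have hψi' := hψi
  rw [← hmap] at hψi'
  refine ⟨hψi'.comp_measurable hmeas, ?_⟩
  have h1 := integral_map (μ := P) hmeas.aemeasurable (f := ψ) hψm.aestronglyMeasurable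
  rw [show ∫ ω, centeredKernel d k (X ω) (Xs i ω) * (g (Xs i ω) - g (X ω)) ^ 2 ∂P =
    ∫ ω, ψ (X ω, (Xs i ω, Ys i ω)) ∂P from rfl, ← h1, hmap, integral_prod _ hψi]
  have hmem : ∀ᵐ x ∂(P.map X), x ∈ Set.Icc (0 : Fin d → ℝ) 1 := by
    rw [h.uniform_X]; exact ae_restrict_mem measurableSet_Icc
  refine integral_le_of_ae_le (by positivity) ?_
  filter_upwards [hmem] with x hx
  have hKx := measurable_centeredKernel_right (d := d) k x
  rw [h.integral_comp_fst (F := fun z => centeredKernel d k x z * (g z - g x) ^ 2)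
    (hKx.mul (by fun_prop))]
  have hint : ∀ j, Integrable (fun z : Fin d → ℝ => centeredKernel d k x z * (z j - x j) ^ 2)
      (volume.restrict (Set.Icc 0 1)) := fun j => by
    refine Integrable.of_bound (hKx.mul (by fun_prop)).aestronglyMeasurable 1 ?_
    filter_upwards [ae_restrict_mem measurableSet_Icc] with z hz
    rw [Real.norm_of_nonneg (mul_nonneg (centeredKernel_nonneg k _ _) (sq_nonneg _))]
    refine mul_le_one₀ (centeredKernel_le_one k _ _) (sq_nonneg _) ?_
    rw [sq_le_one_iff_abs_le_one, abs_le]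
    have h1 : 0 ≤ z j := hz.1 j
    have h2 : z j ≤ 1 := hz.2 j
    have h3 : 0 ≤ x j := hx.1 j
    have h4 : x j ≤ 1 := hx.2 j
    constructor <;> linarith
  -- The squared Lipschitz bound splits into coordinates, matching the one-coordinate displacement
  -- estimate.
  calc _ ≤ ∫ z in Set.Icc (0 : Fin d → ℝ) 1,
        L ^ 2 * ∑ j, centeredKernel d k x z * (z j - x j) ^ 2 := by
        refine integral_mono_of_nonneg (ae_of_all _ fun z =>
          mul_nonneg (centeredKernel_nonneg k _ _) (sq_nonneg _))
          ((integrable_finsetSum _ fun j _ => hint j).const_mul _) ?_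
        filter_upwards [ae_restrict_mem measurableSet_Icc] with z hz
        rw [← Finset.mul_sum, mul_left_comm]
        refine mul_le_mul_of_nonneg_left ?_ (centeredKernel_nonneg k _ _)
        rw [← sq_abs]
        calc |g z - g x| ^ 2 ≤ (L * √(∑ j, (z j - x j) ^ 2)) ^ 2 := by
              gcongr; exact hL z hz x hx
          _ = _ := by rw [mul_pow, Real.sq_sqrt (Finset.sum_nonneg fun j _ => sq_nonneg _)]
    _ = L ^ 2 * ∑ j, ∫ z in Set.Icc (0 : Fin d → ℝ) 1,
          centeredKernel d k x z * (z j - x j) ^ 2 := by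
        rw [integral_const_mul, integral_finsetSum _ fun j _ => hint j]
    _ ≤ L ^ 2 * ∑ _j : Fin d, ((1 / 2 : ℝ) ^ k * (1 - 3 / (4 * d)) ^ k : ℝ) :=
        mul_le_mul_of_nonneg_left
          (Finset.sum_le_sum fun j _ => integral_centeredKernel_mul_sq_le k hx j) (sq_nonneg L)
    _ = _ := by
        rw [Finset.sum_const, Finset.card_univ, Fintype.card_fin, nsmul_eq_mul, mul_assoc]

end GaussianRegressionModel

/-! ### Assembly of the risk bound and the theorem. -/

lemma integral_linear_comb_four {α : Type*} [MeasurableSpace α] {μ : Measure α}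
    {f₁ f₂ f₃ f₄ : α → ℝ} (h₁ : Integrable f₁ μ) (h₂ : Integrable f₂ μ) (h₃ : Integrable f₃ μ)
    (h₄ : Integrable f₄ μ) (a b c e : ℝ) :
    Integrable (fun x => a * f₁ x + b * f₂ x + c * f₃ x + e * f₄ x) μ ∧
    ∫ x, a * f₁ x + b * f₂ x + c * f₃ x + e * f₄ x ∂μ =
      a * ∫ x, f₁ x ∂μ + b * ∫ x, f₂ x ∂μ + c * ∫ x, f₃ x ∂μ + e * ∫ x, f₄ x ∂μ := by
  have h12 : Integrable (fun x => a * f₁ x + b * f₂ x) μ := (h₁.const_mul a).add (h₂.const_mul b)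
  have h123 : Integrable (fun x => a * f₁ x + b * f₂ x + c * f₃ x) μ := h12.add (h₃.const_mul c)
  refine ⟨h123.add (h₄.const_mul e), ?_⟩
  rw [integral_add h123 (h₄.const_mul e), integral_add h12 (h₃.const_mul c),
    integral_add (h₁.const_mul a) (h₂.const_mul b)]
  simp only [integral_const_mul]

/-- The risk of the infinite centered forest for a measurable bounded regression function. -/
lemma kerf_risk_le {Ω : Type*} [MeasurableSpace Ω] {P : Measure Ω} [IsProbabilityMeasure P]
    {d : ℕ} [NeZero d] {g : (Fin d → ℝ) → ℝ} {σ : ℝ≥0} {X : Ω → Fin d → ℝ} {Y : Ω → ℝ}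
    {Xs : ℕ → Ω → Fin d → ℝ} {Ys : ℕ → Ω → ℝ} (h : GaussianRegressionModel P g σ X Y Xs Ys)
    (hg : Measurable g) {B L : ℝ} (hB : ∀ x, |g x| ≤ B)
    (hL : ∀ x ∈ Set.Icc (0 : Fin d → ℝ) 1, ∀ y ∈ Set.Icc (0 : Fin d → ℝ) 1,
      |g x - g y| ≤ L * √(∑ j, (x j - y j) ^ 2)) {l : ℝ} (hl0 : 0 < l)
    (hl : Integrable (fun x : ℝ => Real.exp (l * x ^ 2)) (gaussianReal 0 (σ ^ 2)))
    {n : ℕ} (hn : 2 ≤ n) {v : ℝ}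
    (hv : ∀ x : Fin d → ℝ, ∫ z in Set.Icc (0 : Fin d → ℝ) 1,
      centeredKernel d (Nat.log 2 n) x z ^ 2 ≤ (1 / 2) ^ Nat.log 2 n * v) :
    MemLp (kerfError g X Xs Ys n) 2 P ∧
    kerfRisk P g X Xs Ys n ≤ 8 * L ^ 2 * d * (1 - 3 / (4 * d)) ^ Nat.log 2 n +
      (16 * σ ^ 2 + 64 * B ^ 2 + 32 / l * Real.log n) * v +
      (2 / l * ∫ x, Real.exp (l * x ^ 2) ∂(gaussianReal 0 (σ ^ 2))) / n := by
  have hn0 : n ≠ 0 := by omega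
  have hnR : (0 : ℝ) < n := by positivity
  have hlog : 0 ≤ Real.log n := Real.log_natCast_nonneg n
  have hd : (1 : ℝ) ≤ d := by exact_mod_cast Nat.one_le_iff_ne_zero.2 (NeZero.ne d)
  have hr : (0 : ℝ) ≤ 1 - 3 / (4 * d) := by
    rw [sub_nonneg, div_le_one (by positivity)]; linarith
  set k := Nat.log 2 n with hk
  -- The choice of depth enters here: the mean total weight lies in `[1, 2]`.
  have hM1 : (1 : ℝ) ≤ n * (1 / 2) ^ k := by
    rw [one_div_pow, mul_one_div, one_le_div (by positivity)]
    exact_mod_cast Nat.pow_log_le_self 2 hn0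
  have hM2 : (n : ℝ) * (1 / 2) ^ k ≤ 2 := by
    rw [one_div_pow, mul_one_div, div_le_iff₀ (by positivity), ← pow_succ']
    exact_mod_cast (Nat.lt_pow_succ_log_self (by norm_num) n).le
  have hv0 : 0 ≤ v := by
    have h1 := (integral_nonneg fun z => sq_nonneg _).trans (hv 0)
    exact nonneg_of_mul_nonneg_right h1 (by positivity)
  have hfloor : ⌊Real.logb 2 n⌋₊ = k := by
    exact_mod_cast Real.natFloor_logb_natCast 2 n
  set K : Ω → ℕ → ℝ := fun ω i => centeredKernel d k (X ω) (Xs i ω) with hK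
  set e : Ω → ℕ → ℝ := fun ω i => Ys i ω - g (Xs i ω) with he
  set bound : Ω → ℝ := fun ω =>
    4 * ∑ i ∈ Finset.range n, K ω i * (g (Xs i ω) - g (X ω)) ^ 2 +
      8 * (∑ i ∈ Finset.range n, K ω i * e ω i) ^ 2 +
      (32 * B ^ 2 + 16 / l * Real.log n) * (∑ i ∈ Finset.range n, (K ω i - (1 / 2) ^ k)) ^ 2 +
      2 / l * ∑ j ∈ Finset.range n, Real.exp (l * e ω j ^ 2) / n ^ 2 with hbound
  have hle : ∀ ω, kerfError g X Xs Ys n ω ^ 2 ≤ bound ω := fun ω => by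
    have h1 := sq_weighted_error_le hn0 hl0 hM1 (K := K ω) (g := fun i => g (Xs i ω)) (e := e ω)
      (fun i => centeredKernel_nonneg k _ _) (fun i => hB _) (hB (X ω))
    rw [mul_div_cancel_left₀ _ hnR.ne'] at h1
    simpa only [kerfError, infiniteKeRF, hfloor, he, add_sub_cancel] using h1
  obtain ⟨i2, b2⟩ := h.integral_sq_weighted_noise_le hg hB hv n
  obtain ⟨i3, b3⟩ := h.integral_sq_weight_sub_le hv n
  have i1 : Integrable (fun ω => ∑ i ∈ Finset.range n, K ω i * (g (Xs i ω) - g (X ω)) ^ 2) P :=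
    integrable_finsetSum _ fun i _ => (h.integral_weighted_bias_le hg hB hL k i).1
  have i4 : Integrable (fun ω => ∑ j ∈ Finset.range n, Real.exp (l * e ω j ^ 2) / n ^ 2) P :=
    integrable_finsetSum _ fun i _ => (h.integral_exp_noise hg hl i).1.div_const _
  have b1 : ∫ ω, ∑ i ∈ Finset.range n, K ω i * (g (Xs i ω) - g (X ω)) ^ 2 ∂P ≤
      n * (L ^ 2 * d * ((1 / 2) ^ k * (1 - 3 / (4 * d)) ^ k)) := by
    rw [integral_finsetSum _ fun i _ => (h.integral_weighted_bias_le hg hB hL k i).1]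
    refine (Finset.sum_le_sum fun i _ => (h.integral_weighted_bias_le hg hB hL k i).2).trans_eq ?_
    rw [Finset.sum_const, Finset.card_range, nsmul_eq_mul]
  have b4 : ∫ ω, ∑ j ∈ Finset.range n, Real.exp (l * e ω j ^ 2) / n ^ 2 ∂P =
      (∫ x, Real.exp (l * x ^ 2) ∂(gaussianReal 0 (σ ^ 2))) / n := by
    rw [integral_finsetSum _ fun i _ => (h.integral_exp_noise hg hl i).1.div_const _]
    simp only [integral_div]
    rw [Finset.sum_congr rfl fun i _ => by rw [(h.integral_exp_noise hg hl i).2]]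
    rw [Finset.sum_const, Finset.card_range, nsmul_eq_mul]
    field_simp
  have hbi : Integrable bound P := (integral_linear_comb_four i1 i2 i3 i4 _ _ _ _).1
  have hKm := measurable_centeredKernel (d := d) k
  have hKX : ∀ i, Measurable fun ω => centeredKernel d k (X ω) (Xs i ω) := fun i => by
    have h1 := hKm.comp (h.measurable_X.prodMk (h.measurable_Xs i))
    exact h1
  have hmeas : Measurable (kerfError g X Xs Ys n) := by
    have h1 : kerfError g X Xs Ys n = fun ω =>
        (∑ i ∈ Finset.range n, Ys i ω * centeredKernel d k (X ω) (Xs i ω)) /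
          (∑ i ∈ Finset.range n, centeredKernel d k (X ω) (Xs i ω)) - g (X ω) := by
      funext ω
      simp only [kerfError, infiniteKeRF, hfloor]
    rw [h1]
    exact ((Finset.measurable_sum _ fun i _ => (h.measurable_Ys i).mul (hKX i)).div
      (Finset.measurable_sum _ fun i _ => hKX i)).sub (hg.comp h.measurable_X)
  constructor
  · rw [memLp_two_iff_integrable_sq hmeas.aestronglyMeasurable]
    refine hbi.mono' (hmeas.pow_const 2).aestronglyMeasurable (ae_of_all _ fun ω => ?_)
    rw [Real.norm_of_nonneg (sq_nonneg _)]
    exact hle ω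
  · have h5 : kerfRisk P g X Xs Ys n ≤ ∫ ω, bound ω ∂P :=
      integral_mono_of_nonneg (ae_of_all _ fun ω => sq_nonneg _) hbi (ae_of_all _ hle)
    have h6 : ∫ ω, bound ω ∂P =
        4 * ∫ ω, ∑ i ∈ Finset.range n, K ω i * (g (Xs i ω) - g (X ω)) ^ 2 ∂P +
        8 * ∫ ω, (∑ i ∈ Finset.range n, K ω i * e ω i) ^ 2 ∂P +
        (32 * B ^ 2 + 16 / l * Real.log n) *
          ∫ ω, (∑ i ∈ Finset.range n, (K ω i - (1 / 2) ^ k)) ^ 2 ∂P +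
        2 / l * ∫ ω, ∑ j ∈ Finset.range n, Real.exp (l * e ω j ^ 2) / n ^ 2 ∂P :=
      (integral_linear_comb_four i1 i2 i3 i4 _ _ _ _).2
    have c1 : n * (L ^ 2 * d * ((1 / 2) ^ k * (1 - 3 / (4 * d)) ^ k)) ≤
        2 * L ^ 2 * d * (1 - 3 / (4 * d)) ^ k := by
      calc _ = (n * (1 / 2) ^ k) * (L ^ 2 * d * (1 - 3 / (4 * d)) ^ k) := by ring
        _ ≤ 2 * (L ^ 2 * d * (1 - 3 / (4 * d)) ^ k) := by gcongr
        _ = _ := by ring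
    have c2 : n * (σ ^ 2 * ((1 / 2) ^ k * v)) ≤ 2 * (σ ^ 2 * v) := by
      calc _ = (n * (1 / 2) ^ k) * (σ ^ 2 * v) := by ring
        _ ≤ _ := by gcongr
    have c3 : n * ((1 / 2) ^ k * v) ≤ 2 * v := by
      calc _ = (n * (1 / 2) ^ k) * v := by ring
        _ ≤ _ := by gcongr
    have c4 : (32 * B ^ 2 + 16 / l * Real.log n) *
        ∫ ω, (∑ i ∈ Finset.range n, (K ω i - (1 / 2) ^ k)) ^ 2 ∂P ≤
        (32 * B ^ 2 + 16 / l * Real.log n) * (2 * v) := by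
      gcongr
      exact b3.trans c3
    have c5 := b1.trans c1
    have c6 := b2.trans c2
    calc kerfRisk P g X Xs Ys n ≤ _ := h5.trans_eq h6
      _ ≤ 4 * (2 * L ^ 2 * d * (1 - 3 / (4 * d)) ^ k) + 8 * (2 * (σ ^ 2 * v)) +
          (32 * B ^ 2 + 16 / l * Real.log n) * (2 * v) +
          2 / l * ((∫ x, Real.exp (l * x ^ 2) ∂(gaussianReal 0 (σ ^ 2))) / n) := by
        rw [b4]
        gcongr
      _ = _ := by ring

theorem mainTheorem2 (d : ℕ) [NeZero d] (σ : ℝ≥0) (L B : ℝ) :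
    ∃ C : ℝ, 0 < C ∧
      ∀ fstar : (Fin d → ℝ) → ℝ,
      (∀ x ∈ Set.Icc (0 : Fin d → ℝ) 1, ∀ y ∈ Set.Icc (0 : Fin d → ℝ) 1,
        |fstar x - fstar y| ≤ L * √(∑ j, (x j - y j) ^ 2)) →
      (∀ x ∈ Set.Icc (0 : Fin d → ℝ) 1, |fstar x| ≤ B) →
      ∀ {Ω : Type*} [MeasurableSpace Ω] (P : Measure Ω) [IsProbabilityMeasure P]
        (X : Ω → Fin d → ℝ) (Y : Ω → ℝ) (Xs : ℕ → Ω → Fin d → ℝ) (Ys : ℕ → Ω → ℝ),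
      GaussianRegressionModel P fstar σ X Y Xs Ys →
        (∀ n : ℕ, 2 ≤ n →
          MemLp (kerfError fstar X Xs Ys n) 2 P ∧
          kerfRisk P fstar X Xs Ys n ≤ C * Real.log n ^ (-((d : ℝ) - 11) / 6)) ∧
        (11 < d → Tendsto (kerfRisk P fstar X Xs Ys) atTop (𝓝 0)) := by
  classical
  have hd : (1 : ℝ) ≤ d := by exact_mod_cast Nat.one_le_iff_ne_zero.2 (NeZero.ne d)
  -- Fernique's theorem also covers the degenerate case `σ = 0`, and `l` depends on `σ` only.
  obtain ⟨l, hl0, hl⟩ := IsGaussian.exists_integrable_exp_sq (gaussianReal 0 (σ ^ 2))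
  simp only [Real.norm_eq_abs, sq_abs] at hl
  obtain ⟨A, hA, hKA⟩ := exists_integral_centeredKernel_sq_le d
  have hI : 0 ≤ ∫ x, Real.exp (l * x ^ 2) ∂(gaussianReal 0 (σ ^ 2)) :=
    integral_nonneg fun x => (Real.exp_pos _).le
  obtain ⟨C, hC, hrate⟩ := exists_rate_le d (r := 1 - 3 / (4 * d))
    (a := 8 * L ^ 2 * d) (b := (16 * σ ^ 2 + 64 * B ^ 2) * A) (c := 32 / l * A)
    (e := 2 / l * ∫ x, Real.exp (l * x ^ 2) ∂(gaussianReal 0 (σ ^ 2)))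
    (by rw [sub_nonneg, div_le_one (by positivity)]; linarith)
    (by rw [sub_lt_self_iff]; positivity) (by positivity) (by positivity) (by positivity)
    (by positivity)
  refine ⟨C, hC, fun f hLip hbd Ω _ P _ X Y Xs Ys hmodel => ?_⟩
  -- Nothing is known of `f` off the cube, not even measurability; its extension by zero is bounded,
  -- and measurable because `f` is continuous on the cube.
  set g : (Fin d → ℝ) → ℝ := (Set.Icc (0 : Fin d → ℝ) 1).indicator f with hgdef
  have hfg : ∀ x ∈ Set.Icc (0 : Fin d → ℝ) 1, f x = g x := fun x hx =>
    (Set.indicator_of_mem hx f).symm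
  have hB0 : 0 ≤ B := (abs_nonneg _).trans (hbd 0 ⟨le_refl _, zero_le_one⟩)
  have hgB : ∀ x, |g x| ≤ B := fun x => by
    by_cases hx : x ∈ Set.Icc (0 : Fin d → ℝ) 1
    · rw [← hfg x hx]; exact hbd x hx
    · rw [hgdef, Set.indicator_of_notMem hx, abs_zero]; exact hB0
  have hgL : ∀ x ∈ Set.Icc (0 : Fin d → ℝ) 1, ∀ y ∈ Set.Icc (0 : Fin d → ℝ) 1,
      |g x - g y| ≤ L * √(∑ j, (x j - y j) ^ 2) := fun x hx y hy => by
    rw [← hfg x hx, ← hfg y hy]; exact hLip x hx y hy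
  have hcont : ContinuousOn f (Set.Icc 0 1) := by
    intro x hx
    rw [ContinuousWithinAt, tendsto_iff_dist_tendsto_zero]
    have h1 : Tendsto (fun y : Fin d → ℝ => L * √(∑ j, (y j - x j) ^ 2))
        (𝓝[Set.Icc 0 1] x) (𝓝 0) := by
      have : Continuous fun y : Fin d → ℝ => L * √(∑ j, (y j - x j) ^ 2) := by fun_prop
      simpa using (this.tendsto x).mono_left nhdsWithin_le_nhds
    refine squeeze_zero' (Eventually.of_forall fun y => dist_nonneg) ?_ h1
    filter_upwards [self_mem_nhdsWithin] with y hy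
    rw [Real.dist_eq]
    exact hLip y hy x hx
  have hgm : Measurable g := by
    have h1 := hcont.measurable_piecewise (g := fun _ => (0 : ℝ)) continuousOn_const
      measurableSet_Icc
    rwa [hgdef, ← Set.piecewise_eq_indicator]
  have hmodelg := hmodel.congr hfg
  have herr : ∀ n, kerfError g X Xs Ys n =ᵐ[P] kerfError f X Xs Ys n := fun n => by
    filter_upwards [hmodel.ae_mem_Icc] with ω hω
    simp only [kerfError, hfg _ hω]
  have hrisk : ∀ n, kerfRisk P f X Xs Ys n = kerfRisk P g X Xs Ys n := fun n => by
    refine integral_congr_ae ?_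
    filter_upwards [herr n] with ω hω
    rw [hω]
  have main : ∀ n : ℕ, 2 ≤ n → MemLp (kerfError f X Xs Ys n) 2 P ∧
      kerfRisk P f X Xs Ys n ≤ C * Real.log n ^ (-((d : ℝ) - 11) / 6) := by
    intro n hn
    have hk : Nat.log 2 n ≠ 0 := (Nat.log_pos (by norm_num) hn).ne'
    obtain ⟨h1, h2⟩ := kerf_risk_le hmodelg hgm hgB hgL hl0 hl hn (hKA _ hk)
    refine ⟨(memLp_congr_ae (herr n)).1 h1, ?_⟩
    rw [hrisk]
    refine (h2.trans_eq ?_).trans (hrate n hn)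
    ring
  refine ⟨main, fun hd11 => ?_⟩
  have hd' : (11 : ℝ) < d := by exact_mod_cast hd11
  have hlim : Tendsto (fun n : ℕ => C * Real.log n ^ (-((d : ℝ) - 11) / 6)) atTop (𝓝 0) := by
    have h1 : Tendsto (fun n : ℕ => Real.log n) atTop atTop :=
      Real.tendsto_log_atTop.comp tendsto_natCast_atTop_atTop
    have h2 := ((tendsto_rpow_neg_atTop (y := ((d : ℝ) - 11) / 6) (by linarith)).comp h1).const_mul C
    simpa only [Function.comp_def, neg_div, mul_zero] using h2
  refine squeeze_zero' (Eventually.of_forall fun n => integral_nonneg fun ω => sq_nonneg _) ?_ hlim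
  filter_upwards [eventually_ge_atTop 2] with n hn
  exact (main n hn).2
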